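/- Let $(\mathcal E,\otimes,\mathbf 1)$ be a symmetric monoidal category and let $FI$ be the symmetric monoidal category of finite sets and injections, with the disjoint union as tensor product and $\emptyset$ as unit. Denote by $\mathrm{Iso}(FI\downarrow FI)$ the symmetric monoidal groupoid whose objects are the morphisms of $FI$ and whose morphisms $\phi\to\phi'$ are the pairs $(\sigma\Downarrow\sigma')$ of isomorphisms with $\sigma'\circ\phi=\phi'\circ\sigma$. A \emph{weak (indexed) enrichment} of $FI$ in $\mathcal E$ is given by a weak enrichment functor, that is, by (1) a strong symmetric monoidal functor $\mathcal D:\mathrm{Iso}(FI\downarrow FI)\to\mathcal E$; (2) for every pair of composable morphisms $\phi_1:X\to Y$, $\phi_0:Y\to Z$, a morphism $\mathcal D(\phi_0)\otimes\mathcal D(\phi_1)\to\mathcal D(\phi_0\circ\phi_1)$, natural with respect to pairs $(\sigma\Downarrow\sigma')$, $(\sigma'\Downarrow\sigma'')$, and associative; (3) for every object $X$ a morphism $u_X:\mathbf 1\to\mathcal D(\mathrm{id}_X)$, natural in isomorphisms of $X$, which is a two-sided unit for the maps in (2); such that (2) and (3) are compatible with the monoidal structure of $\mathcal D$ (interchange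 relation; $u_{X\sqcup Y}$ corresponds to $u_X\otimes u_Y$, and $u_\emptyset$ is the unit constraint of $\mathcal D$). Morphisms of weak enrichments are the monoidal natural transformations which are compatible with (2) and (3). Let $*$ be a one-point set and $i:\emptyset\to *$ the injection. For every weak enrichment $\mathcal D$, the object $A=\mathcal D(\mathrm{id}_*)$ is a unital associative monoid (algebra) in $\mathcal E$ with multiplication given by $\mathrm{id}_*\circ\mathrm{id}_*=\mathrm{id}_*$ and unit $u_*$, and $M=\mathcal D(i)$ is a left $A$-module with action given by $\mathrm{id}_*\circ i=i$. The assignment $\mathcal D\mapsto(A,M)$ is an equivalence from the category of weak enrichments of $FI$ in $\mathcal E$ to the category of pairs $(A,M)$ of a unital associative monoid $A$ in $\mathcal E$ and a left $A$-module $M$ (a morphism $(A,M)\to(A',M')$ being a homomorphism of monoids $f:A\to A'$ together with a morphism $g:M\to M'$ in $\mathcal E$ that is equivariant along $f$). In particular, weak enrichments of $FI$ in $\mathcal E$ are, up to isomorphism, in one-to-one correspondence with pairs $(A,M)$ up to isomorphism. -/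

import Mathlib

open CategoryTheory MonoidalCategory

universe w v u v' u'

/-! ## The symmetric monoidal category of finite sets and injections -/

/-- A finite set, regarded as an object of the category `FI`. -/
structure FI : Type (w + 1) where
  /-- The underlying set. -/
  carrier : Type w
  [finite : Finite carrier]

namespace FI

attribute [instance] FI.finite

/-- A morphism of `FI` is an injective map. -/
@[ext]
structure Hom (X Y : FI.{w}) : Type w where
  /-- The underlying injective map. -/
  emb : X.carrier ↪ Y.carrier

instance : Category FI.{w} where
  Hom X Y := Hom X Y
  id X := ⟨Function.Embedding.refl X.carrier⟩
  comp f g := ⟨f.emb.trans g.emb⟩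

@[ext]
theorem hom_ext {X Y : FI.{w}} {f g : X ⟶ Y} (h : ∀ x, f.emb x = g.emb x) : f = g :=
  Hom.ext (DFunLike.ext _ _ h)

@[simp] theorem id_emb (X : FI.{w}) (x : X.carrier) : (𝟙 X : X ⟶ X).emb x = x := rfl

@[simp] theorem comp_emb {X Y Z : FI.{w}} (f : X ⟶ Y) (g : Y ⟶ Z) (x : X.carrier) :
    (f ≫ g).emb x = g.emb (f.emb x) := rfl

/-- A bijection of finite sets is an isomorphism of `FI`. -/
def isoOfEquiv {X Y : FI.{w}} (e : X.carrier ≃ Y.carrier) : X ≅ Y where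
  hom := ⟨e.toEmbedding⟩
  inv := ⟨e.symm.toEmbedding⟩
  hom_inv_id := hom_ext fun x => e.symm_apply_apply x
  inv_hom_id := hom_ext fun x => e.apply_symm_apply x

/-- The tensor product is the disjoint union, the unit is the empty set. -/
instance : MonoidalCategoryStruct FI.{w} where
  tensorObj X Y := ⟨X.carrier ⊕ Y.carrier⟩
  tensorHom f g := ⟨f.emb.sumMap g.emb⟩
  whiskerLeft X _ _ f := ⟨(Function.Embedding.refl X.carrier).sumMap f.emb⟩
  whiskerRight f X := ⟨f.emb.sumMap (Function.Embedding.refl X.carrier)⟩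
  tensorUnit := ⟨PEmpty.{w + 1}⟩
  associator X Y Z := isoOfEquiv (Equiv.sumAssoc X.carrier Y.carrier Z.carrier)
  leftUnitor X := isoOfEquiv (Equiv.emptySum PEmpty.{w + 1} X.carrier)
  rightUnitor X := isoOfEquiv (Equiv.sumEmpty X.carrier PEmpty.{w + 1})

instance : MonoidalCategory FI.{w} where
  tensorHom_def _ _ := hom_ext (by rintro (_ | _) <;> rfl)
  id_tensorHom_id _ _ := hom_ext (by rintro (_ | _) <;> rfl)
  tensorHom_comp_tensorHom _ _ _ _ := hom_ext (by rintro (_ | _) <;> rfl)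
  whiskerLeft_id _ _ := hom_ext (by rintro (_ | _) <;> rfl)
  id_whiskerRight _ _ := hom_ext (by rintro (_ | _) <;> rfl)
  associator_naturality _ _ _ := hom_ext (by rintro ((_ | _) | _) <;> rfl)
  leftUnitor_naturality _ := hom_ext (by rintro (x | _); exacts [x.elim, rfl])
  rightUnitor_naturality _ := hom_ext (by rintro (_ | x); exacts [rfl, x.elim])
  pentagon _ _ _ _ := hom_ext (by rintro (((_ | _) | _) | _) <;> rfl)
  triangle _ _ := hom_ext (by rintro ((_ | x) | _); exacts [rfl, x.elim, rfl])

instance : SymmetricCategory FI.{w} where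
  braiding X Y := isoOfEquiv (Equiv.sumComm X.carrier Y.carrier)
  braiding_naturality_right _ _ _ _ := hom_ext (by rintro (_ | _) <;> rfl)
  braiding_naturality_left _ _ := hom_ext (by rintro (_ | _) <;> rfl)
  hexagon_forward _ _ _ := hom_ext (by rintro ((_ | _) | _) <;> rfl)
  hexagon_reverse _ _ _ := hom_ext (by rintro (_ | _ | _) <;> rfl)
  symmetry _ _ := hom_ext (by rintro (_ | _) <;> rfl)

/-- The one-element set. -/
def pt : FI.{w} := ⟨PUnit.{w + 1}⟩

/-- The injection `∅ ⟶ pt`. -/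
def fromEmpty : 𝟙_ FI.{w} ⟶ pt.{w} := ⟨⟨fun x => x.elim, fun x => x.elim⟩⟩

end FI

/-! ## The groupoid of morphisms of a symmetric monoidal category -/

section

variable (F : Type u') [Category.{v'} F]

/-- The objects of the groupoid `Iso(F ↓ F)`: the morphisms of `F`. -/
structure IsoArrow : Type (max u' v') where
  /-- The source. -/
  {src : F}
  /-- The target. -/
  {tgt : F}
  /-- The morphism. -/
  arr : src ⟶ tgt

namespace IsoArrow

variable {F}

/-- The morphisms `(σ ⇓ σ') : φ ⟶ φ'` of `Iso(F ↓ F)`: the commutative squares from `φ` to `φ'`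
whose other two sides `σ`, `σ'` are isomorphisms. -/
@[ext]
structure Hom (φ φ' : IsoArrow F) : Type v' where
  /-- The isomorphism between the sources. -/
  left : φ.src ≅ φ'.src
  /-- The isomorphism between the targets. -/
  right : φ.tgt ≅ φ'.tgt
  w : φ.arr ≫ right.hom = left.hom ≫ φ'.arr

instance : Category (IsoArrow F) where
  Hom φ φ' := Hom φ φ'
  id φ := ⟨Iso.refl _, Iso.refl _, by simp⟩
  comp a b := ⟨a.left ≪≫ b.left, a.right ≪≫ b.right, by
    simp only [Iso.trans_hom, Category.assoc, ← b.w, reassoc_of% a.w]⟩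

@[ext]
theorem hom_ext {φ φ' : IsoArrow F} {a b : φ ⟶ φ'} (hl : a.left.hom = b.left.hom)
    (hr : a.right.hom = b.right.hom) : a = b :=
  Hom.ext (Iso.ext hl) (Iso.ext hr)

@[simp] theorem id_left (φ : IsoArrow F) : (𝟙 φ : φ ⟶ φ).left = Iso.refl _ := rfl
@[simp] theorem id_right (φ : IsoArrow F) : (𝟙 φ : φ ⟶ φ).right = Iso.refl _ := rfl
@[simp] theorem comp_left {φ φ' φ'' : IsoArrow F} (a : φ ⟶ φ') (b : φ' ⟶ φ'') :
    (a ≫ b).left = a.left ≪≫ b.left := rfl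
@[simp] theorem comp_right {φ φ' φ'' : IsoArrow F} (a : φ ⟶ φ') (b : φ' ⟶ φ'') :
    (a ≫ b).right = a.right ≪≫ b.right := rfl

/-- A commutative square with invertible sides is an isomorphism. -/
def isoMk {φ φ' : IsoArrow F} (l : φ.src ≅ φ'.src) (r : φ.tgt ≅ φ'.tgt)
    (h : φ.arr ≫ r.hom = l.hom ≫ φ'.arr) : φ ≅ φ' where
  hom := ⟨l, r, h⟩
  inv := ⟨l.symm, r.symm, by
    rw [Iso.symm_hom, Iso.symm_hom, Iso.eq_inv_comp, ← Category.assoc, ← h, Category.assoc,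
      Iso.hom_inv_id, Category.comp_id]⟩
  hom_inv_id := by ext <;> simp
  inv_hom_id := by ext <;> simp

/-- Equal morphisms `f = g` of `F`, as isomorphic objects of `Iso(F ↓ F)` (by the square with
identity sides). -/
def ofEq {X Y : F} {f g : X ⟶ Y} (h : f = g) : (⟨f⟩ : IsoArrow F) ⟶ ⟨g⟩ :=
  ⟨Iso.refl _, Iso.refl _, by simp [h]⟩

/-- The square `(σ ⇓ σ) : id_X ⟶ id_X'` of an isomorphism `σ : X ≅ X'`. -/
def idSquare {X X' : F} (σ : X ≅ X') : (⟨𝟙 X⟩ : IsoArrow F) ⟶ ⟨𝟙 X'⟩ :=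
  ⟨σ, σ, by simp⟩

variable [MonoidalCategory F]

/-- The tensor product of morphisms and of squares, inherited from `F`. -/
instance : MonoidalCategoryStruct (IsoArrow F) where
  tensorObj φ ψ := ⟨φ.arr ⊗ₘ ψ.arr⟩
  tensorHom a b := ⟨a.left ⊗ᵢ b.left, a.right ⊗ᵢ b.right, by simp [a.w, b.w]⟩
  whiskerLeft φ _ _ b := ⟨whiskerLeftIso _ b.left, whiskerLeftIso _ b.right, by
    simp [← id_tensorHom, b.w]⟩
  whiskerRight a ψ := ⟨whiskerRightIso a.left _, whiskerRightIso a.right _, by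
    simp [← tensorHom_id, a.w]⟩
  tensorUnit := ⟨𝟙 (𝟙_ F)⟩
  associator _ _ _ := isoMk (α_ _ _ _) (α_ _ _ _) (by simp)
  leftUnitor _ := isoMk (λ_ _) (λ_ _) (by simp)
  rightUnitor _ := isoMk (ρ_ _) (ρ_ _) (by simp)

instance : MonoidalCategory (IsoArrow F) where
  tensorHom_def _ _ := hom_ext (tensorHom_def _ _) (tensorHom_def _ _)
  id_tensorHom_id _ _ := hom_ext (id_tensorHom_id _ _) (id_tensorHom_id _ _)
  tensorHom_comp_tensorHom _ _ _ _ :=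
    hom_ext (tensorHom_comp_tensorHom _ _ _ _) (tensorHom_comp_tensorHom _ _ _ _)
  whiskerLeft_id _ _ := hom_ext (whiskerLeft_id _ _) (whiskerLeft_id _ _)
  id_whiskerRight _ _ := hom_ext (id_whiskerRight _ _) (id_whiskerRight _ _)
  associator_naturality _ _ _ :=
    hom_ext (associator_naturality _ _ _) (associator_naturality _ _ _)
  leftUnitor_naturality _ := hom_ext (leftUnitor_naturality _) (leftUnitor_naturality _)
  rightUnitor_naturality _ := hom_ext (rightUnitor_naturality _) (rightUnitor_naturality _)
  pentagon _ _ _ _ := hom_ext (pentagon _ _ _ _) (pentagon _ _ _ _)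
  triangle _ _ := hom_ext (triangle _ _) (triangle _ _)

instance [SymmetricCategory F] : SymmetricCategory (IsoArrow F) where
  braiding _ _ := isoMk (β_ _ _) (β_ _ _) (BraidedCategory.braiding_naturality _ _)
  braiding_naturality_right _ _ _ _ :=
    hom_ext (BraidedCategory.braiding_naturality_right _ _)
      (BraidedCategory.braiding_naturality_right _ _)
  braiding_naturality_left _ _ :=
    hom_ext (BraidedCategory.braiding_naturality_left _ _)
      (BraidedCategory.braiding_naturality_left _ _)
  hexagon_forward _ _ _ :=
    hom_ext (BraidedCategory.hexagon_forward _ _ _) (BraidedCategory.hexagon_forward _ _ _)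
  hexagon_reverse _ _ _ :=
    hom_ext (BraidedCategory.hexagon_reverse _ _ _) (BraidedCategory.hexagon_reverse _ _ _)
  symmetry _ _ := hom_ext (SymmetricCategory.symmetry _ _) (SymmetricCategory.symmetry _ _)

end IsoArrow

end

/-! ## Weak enrichment functors -/

section

variable (F : Type u') [Category.{v'} F] [MonoidalCategory F] [SymmetricCategory F]
variable (E : Type u) [Category.{v} E] [MonoidalCategory E] [SymmetricCategory E]

/-- A weak enrichment functor for `F` with values in `E`: a symmetric monoidal, horizontally lax
functor from the double category of `F` (horizontal morphisms: the morphisms of `F`; vertical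
morphisms: the isomorphisms of `F`; 2-cells: the commutative squares) to `E`, regarded as a double
category with one object and only the identity as vertical morphism. -/
structure WeakEnrichmentFunctor where
  /-- The groupoid data: the functor `Iso(F ↓ F) ⥤ E`. -/
  D : IsoArrow F ⥤ E
  /-- `D` is (strong) symmetric monoidal. -/
  [braided : D.Braided]
  /-- The composition data `D(g) ⊗ D(f) ⟶ D(g ∘ f)`, indexed by all commutative triangles
  `h = g ∘ f`. -/
  comp {X Y Z : F} (f : X ⟶ Y) (g : Y ⟶ Z) (h : X ⟶ Z) (t : f ≫ g = h) :
    D.obj ⟨g⟩ ⊗ D.obj ⟨f⟩ ⟶ D.obj ⟨h⟩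
  /-- The unit data `𝟙 ⟶ D(id_X)`. -/
  unit (X : F) : 𝟙_ E ⟶ D.obj ⟨𝟙 X⟩
  /-- Naturality of the composition in horizontally composable 2-cells `a`, `b` with horizontal
  composite `c`. -/
  comp_naturality {X Y Z X' Y' Z' : F} {f : X ⟶ Y} {g : Y ⟶ Z} {h : X ⟶ Z}
    {f' : X' ⟶ Y'} {g' : Y' ⟶ Z'} {h' : X' ⟶ Z'} (t : f ≫ g = h) (t' : f' ≫ g' = h')
    (a : (⟨f⟩ : IsoArrow F) ⟶ ⟨f'⟩) (b : (⟨g⟩ : IsoArrow F) ⟶ ⟨g'⟩)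
    (c : (⟨h⟩ : IsoArrow F) ⟶ ⟨h'⟩)
    (hab : a.right = b.left) (hac : c.left = a.left) (hbc : c.right = b.right) :
    (D.map b ⊗ₘ D.map a) ≫ comp f' g' h' t' = comp f g h t ≫ D.map c
  /-- Naturality of the unit in vertical morphisms. -/
  unit_naturality {X X' : F} (σ : X ≅ X') : unit X ≫ D.map (IsoArrow.idSquare σ) = unit X'
  /-- The composition is associative. -/
  comp_assoc {W X Y Z : F} {f : W ⟶ X} {g : X ⟶ Y} {h : Y ⟶ Z} {fg : W ⟶ Y} {gh : X ⟶ Z}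
    {fgh : W ⟶ Z} (t₁ : f ≫ g = fg) (t₂ : g ≫ h = gh) (t₃ : f ≫ gh = fgh) (t₄ : fg ≫ h = fgh) :
    comp g h gh t₂ ▷ D.obj ⟨f⟩ ≫ comp f gh fgh t₃ =
      (α_ _ _ _).hom ≫ D.obj ⟨h⟩ ◁ comp f g fg t₁ ≫ comp fg h fgh t₄
  /-- The unit data is a left unit for the composition. -/
  unit_comp {X Y : F} (f : X ⟶ Y) :
    unit Y ▷ D.obj ⟨f⟩ ≫ comp f (𝟙 Y) f (Category.comp_id f) = (λ_ _).hom
  /-- The unit data is a right unit for the composition. -/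
  comp_unit {X Y : F} (f : X ⟶ Y) :
    D.obj ⟨f⟩ ◁ unit X ≫ comp (𝟙 X) f f (Category.id_comp f) = (ρ_ _).hom
  /-- The interchange relation between composition and tensor product. -/
  comp_tensor {X Y Z X' Y' Z' : F} {f : X ⟶ Y} {g : Y ⟶ Z} {h : X ⟶ Z}
    {f' : X' ⟶ Y'} {g' : Y' ⟶ Z'} {h' : X' ⟶ Z'} (t : f ≫ g = h) (t' : f' ≫ g' = h') :
    (Functor.LaxMonoidal.μ D ⟨g⟩ ⟨g'⟩ ⊗ₘ Functor.LaxMonoidal.μ D ⟨f⟩ ⟨f'⟩) ≫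
        comp (f ⊗ₘ f') (g ⊗ₘ g') (h ⊗ₘ h')
          (by rw [MonoidalCategory.tensorHom_comp_tensorHom, t, t']) =
      MonoidalCategory.tensorμ _ _ _ _ ≫ (comp f g h t ⊗ₘ comp f' g' h' t') ≫
        Functor.LaxMonoidal.μ D ⟨h⟩ ⟨h'⟩
  /-- The unit data is compatible with the tensor product. -/
  unit_tensor (X Y : F) :
    (λ_ (𝟙_ E)).inv ≫ (unit X ⊗ₘ unit Y) ≫ Functor.LaxMonoidal.μ D ⟨𝟙 X⟩ ⟨𝟙 Y⟩ ≫
      D.map (IsoArrow.ofEq (MonoidalCategory.id_tensorHom_id X Y)) = unit (X ⊗ Y)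
  /-- The unit data is compatible with the monoidal unit. -/
  unit_tensorUnit : unit (𝟙_ F) = Functor.LaxMonoidal.ε D

end

namespace WeakEnrichmentFunctor

attribute [instance] WeakEnrichmentFunctor.braided

variable {F : Type u'} [Category.{v'} F] [MonoidalCategory F] [SymmetricCategory F]
variable {E : Type u} [Category.{v} E] [MonoidalCategory E] [SymmetricCategory E]

/-- A morphism of weak enrichment functors: a monoidal natural transformation which is compatible
with the composition data and the unit data. -/
@[ext]
structure Hom (P Q : WeakEnrichmentFunctor F E) where
  /-- The natural transformation. -/
  nat : P.D ⟶ Q.D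
  [isMonoidal : NatTrans.IsMonoidal nat]
  comp_nat {X Y Z : F} (f : X ⟶ Y) (g : Y ⟶ Z) (h : X ⟶ Z) (t : f ≫ g = h) :
    P.comp f g h t ≫ nat.app ⟨h⟩ = (nat.app ⟨g⟩ ⊗ₘ nat.app ⟨f⟩) ≫ Q.comp f g h t
  unit_nat (X : F) : P.unit X ≫ nat.app ⟨𝟙 X⟩ = Q.unit X

attribute [instance] Hom.isMonoidal

instance : Category (WeakEnrichmentFunctor F E) where
  Hom P Q := Hom P Q
  id P := { nat := 𝟙 P.D, comp_nat := by simp, unit_nat := by simp }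
  comp a b :=
    { nat := a.nat ≫ b.nat
      comp_nat := fun f g h t => by
        rw [NatTrans.comp_app, ← Category.assoc, a.comp_nat, Category.assoc, b.comp_nat,
          NatTrans.comp_app, NatTrans.comp_app,
          ← MonoidalCategory.tensorHom_comp_tensorHom, Category.assoc]
      unit_nat := fun X => by
        rw [NatTrans.comp_app, ← Category.assoc, a.unit_nat, b.unit_nat] }

@[simp] theorem id_nat (P : WeakEnrichmentFunctor F E) : (𝟙 P : P ⟶ P).nat = 𝟙 P.D := rfl

@[simp] theorem comp_nat' {P Q R : WeakEnrichmentFunctor F E} (a : P ⟶ Q) (b : Q ⟶ R) :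
    (a ≫ b).nat = a.nat ≫ b.nat := rfl

end WeakEnrichmentFunctor

/-! ## Pairs of a monoid and a module -/

section

variable (E : Type u) [Category.{v} E] [MonoidalCategory E]

/-- A pair `(A, M)` of a (unital, associative) monoid `A` in `E` and a left `A`-module `M`. -/
structure MonoidModulePair where
  /-- The monoid. -/
  A : E
  /-- The module. -/
  M : E
  [mon : MonObj A]
  [mod : ModObj A M]

namespace MonoidModulePair

attribute [instance] MonoidModulePair.mon MonoidModulePair.mod

variable {E}

/-- A morphism `(A, M) ⟶ (A', M')`: a homomorphism of monoids `A ⟶ A'` together with an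
equivariant morphism `M ⟶ M'`. -/
@[ext]
structure Hom (P Q : MonoidModulePair E) where
  /-- The homomorphism of monoids. -/
  homA : P.A ⟶ Q.A
  /-- The equivariant morphism. -/
  homM : P.M ⟶ Q.M
  [isMonHom : IsMonHom homA]
  smul_hom : ModObj.smul (M := P.A) (X := P.M) ≫ homM =
    (homA ⊗ₘ homM) ≫ ModObj.smul (M := Q.A) (X := Q.M)

attribute [instance] Hom.isMonHom

instance : Category (MonoidModulePair E) where
  Hom P Q := Hom P Q
  id P := { homA := 𝟙 P.A, homM := 𝟙 P.M, smul_hom := by simp }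
  comp a b :=
    { homA := a.homA ≫ b.homA
      homM := a.homM ≫ b.homM
      smul_hom := by
        rw [← Category.assoc, a.smul_hom, Category.assoc, b.smul_hom,
          ← MonoidalCategory.tensorHom_comp_tensorHom, Category.assoc] }

@[ext]
theorem hom_ext {P Q : MonoidModulePair E} {a b : P ⟶ Q} (hA : a.homA = b.homA)
    (hM : a.homM = b.homM) : a = b :=
  Hom.ext hA hM

end MonoidModulePair

end

/-! ## The pair of a weak enrichment functor for `FI` -/

namespace WeakEnrichmentFunctor

variable {E : Type u} [Category.{v} E] [MonoidalCategory E] [SymmetricCategory E]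

/-- The monoid `A = D(id_pt)`: its unit is the unit datum of `pt`, its multiplication is the
composition datum of `id_pt ∘ id_pt = id_pt`. -/
@[reducible]
def monObj (P : WeakEnrichmentFunctor FI.{w} E) : MonObj (P.D.obj ⟨𝟙 FI.pt⟩) where
  one := P.unit FI.pt
  mul := P.comp (𝟙 FI.pt) (𝟙 FI.pt) (𝟙 FI.pt) (Category.comp_id _)
  one_mul := P.unit_comp _
  mul_one := P.comp_unit _
  mul_assoc := P.comp_assoc _ _ _ _

/-- The `A`-module `M = D(∅ ⟶ pt)`: the action is the composition datum of
`id_pt ∘ (∅ ⟶ pt) = (∅ ⟶ pt)`. -/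
@[reducible]
def modObj (P : WeakEnrichmentFunctor FI.{w} E) :
    letI := P.monObj
    ModObj (P.D.obj ⟨𝟙 FI.pt⟩) (P.D.obj ⟨FI.fromEmpty⟩) :=
  letI := P.monObj
  { smul := P.comp FI.fromEmpty (𝟙 FI.pt) FI.fromEmpty (Category.comp_id _)
    one_smul := P.unit_comp _
    mul_smul := P.comp_assoc _ _ _ _ }

variable (E) in
/-- The functor which sends a weak enrichment functor `D` for `FI` to the pair
`(D(id_pt), D(∅ ⟶ pt))`. -/
def toPair : WeakEnrichmentFunctor FI.{w} E ⥤ MonoidModulePair E where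
  obj P :=
    letI := P.monObj
    letI := P.modObj
    { A := P.D.obj ⟨𝟙 FI.pt⟩, M := P.D.obj ⟨FI.fromEmpty⟩ }
  map {P Q} a :=
    letI := P.monObj
    letI := P.modObj
    letI := Q.monObj
    letI := Q.modObj
    { homA := a.nat.app ⟨𝟙 FI.pt⟩
      homM := a.nat.app ⟨FI.fromEmpty⟩
      isMonHom := ⟨a.unit_nat _, a.comp_nat _ _ _ _⟩
      smul_hom := a.comp_nat _ _ _ _ }
  map_id _ := rfl
  map_comp _ _ := rfl

end WeakEnrichmentFunctor

/-! An isomorphism between two injections is the same as a bijection of their targets that respects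
the images, since the bijection of the sources is then forced. So `Iso(FI ↓ FI)` is the groupoid of
finite sets with two colours (in the image or not), which is the free symmetric monoidal category on
two objects: the identity of the point and the injection of the empty set into the point. A
symmetric monoidal functor `D` out of it amounts to two objects `A` and `M`, and a monoidal
transformation to an arbitrary pair of morphisms between such objects.

The rest of the structure is treated in the same way. Composable pairs `X ⟶ Y ⟶ Z` with their
isomorphisms form the groupoid of finite sets with three colours (elements of `Z` coming from `X`,
from `Y` only, or from neither). Naturality and interchange say that the composition data is a
monoidal transformation of functors on this groupoid, so it is freely given by its values on three
generators: a map `A ⊗ A ⟶ A`, a map `A ⊗ M ⟶ M`, and a map `M ⊗ D(id_∅) ⟶ M`. The last one is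
forced by the right unit law to be the right unitor, up to `D(id_∅) ≅ 𝟙_ E`. The unit data is a
monoidal transformation on finite sets with one colour, given by one map `𝟙_ E ⟶ A`.

Associativity, the unit laws and compatibility with transformations are stable under isomorphism and
disjoint union, so they only need to be checked on chains of injections that end in the point
(`FI.chain_induction`). There they are the axioms of a monoid, of a module, or of their
homomorphisms; chains beginning with the identity of the empty set impose nothing. This yields
faithfulness, fullness and essential surjectivity of `toPair`.

Freeness is made concrete by `FreelyGenerates`: morphisms between tensor products of generators are
in bijection with permutations of lists, encoded as iterated insertions (`PermData`). A permutation
acts on tensor products in every symmetric monoidal category. Composition, concatenation,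
associators and braidings are realised by operations on permutations, so an equation between
structural morphisms in `E` follows from the corresponding equation in the generated category.
Transformations and functors are then constructed in `FreelyGenerates.exists_natTrans` and
`FreelyGenerates.lift`. -/

/-! ## Tensor products of lists and permutations of lists -/

section ListTensor

universe z

variable {C : Type z}
variable {E : Type u} [Category.{v} E] [MonoidalCategory E]

/-- The (right bracketed) tensor product of the objects indexed by a list. -/
def listTensor (V : C → E) : List C → E
  | [] => 𝟙_ E
  | a :: l => V a ⊗ listTensor V l

/-- The ways to insert an element `a` into a list. -/
inductive Insertion (a : C) : List C → List C → Type z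
  | here (l : List C) : Insertion a l (a :: l)
  | there (b : C) {l l' : List C} (i : Insertion a l l') : Insertion a (b :: l) (b :: l')

/-- The permutations which carry a list to another one. -/
inductive PermData : List C → List C → Type z
  | nil : PermData [] []
  | cons {a : C} {l m l' : List C} (p : PermData l m) (i : Insertion a m l') : PermData (a :: l) l'

/-- The associativity isomorphism for the tensor product of the concatenation of two lists. -/
def listTensorAppend (V : C → E) : (l m : List C) →
    (listTensor V l ⊗ listTensor V m ≅ listTensor V (l ++ m))
  | [], m => λ_ (listTensor V m)
  | a :: l, m => α_ (V a) (listTensor V l) (listTensor V m) ≪≫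
      whiskerLeftIso (V a) (listTensorAppend V l m)

namespace PermData

/-- The identity permutation. -/
def refl : (l : List C) → PermData l l
  | [] => .nil
  | _ :: l => .cons (refl l) (.here l)

end PermData

namespace Insertion

/-- Two successive insertions, performed in the opposite order. -/
def exchange {a b : C} : {l m n : List C} → Insertion a l m → Insertion b m n →
    (k : List C) × Insertion b l k × Insertion a k n
  | l, _, _, i, .here _ => ⟨b :: l, .here l, .there b i⟩
  | _, _, _, .here _, .there (l' := n) _ j => ⟨n, j, .here n⟩
  | _, _, _, .there c i, .there _ j =>
    ⟨c :: (exchange i j).1, .there c (exchange i j).2.1, .there c (exchange i j).2.2⟩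

/-- The insertion into the first part of a concatenation. -/
def append {a : C} {l l' : List C} (i : Insertion a l l') (m : List C) :
    Insertion a (l ++ m) (l' ++ m) :=
  match i with
  | .here l => .here (l ++ m)
  | .there b i => .there b (i.append m)

/-- The insertion between the two parts of a concatenation. -/
def middle (a : C) : (l m : List C) → Insertion a (l ++ m) (l ++ a :: m)
  | [], m => .here m
  | b :: l, m => .there b (middle a l m)

end Insertion

namespace PermData

/-- What remains of a permutation after removing one element. -/
def extract {a : C} : {l m n : List C} → Insertion a l m → PermData m n →
    (k : List C) × PermData l k × Insertion a k n
  | _, _, _, .here _, .cons p i => ⟨_, p, i⟩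
  | _, _, _, .there _ i, .cons p j =>
    ⟨((extract i p).2.2.exchange j).1,
      .cons (extract i p).2.1 ((extract i p).2.2.exchange j).2.1,
      ((extract i p).2.2.exchange j).2.2⟩

/-- The composition of permutations. -/
def comp : {l m n : List C} → PermData l m → PermData m n → PermData l n
  | _, _, _, .nil, q => q
  | _, _, _, .cons p i, q => .cons (p.comp (q.extract i).2.1) (q.extract i).2.2

/-- The concatenation of permutations. -/
def append {l l' m m' : List C} (p : PermData l l') (q : PermData m m') :
    PermData (l ++ m) (l' ++ m') :=
  match p with
  | .nil => q
  | .cons p i => .cons (p.append q) (i.append m')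

/-- The identity permutation from `(l ++ m) ++ n` to `l ++ (m ++ n)`. -/
def assoc : (l m n : List C) → PermData (l ++ m ++ n) (l ++ (m ++ n))
  | [], m, n => refl (m ++ n)
  | _ :: l, m, n => .cons (assoc l m n) (.here _)

/-- The identity permutation from `l ++ []` to `l`. -/
def appendNil : (l : List C) → PermData (l ++ []) l
  | [] => .nil
  | _ :: l => .cons (appendNil l) (.here _)

/-- The identity permutation from `l` to `l ++ []`. -/
def nilAppend : (l : List C) → PermData l (l ++ [])
  | [] => .nil
  | _ :: l => .cons (nilAppend l) (.here _)

/-- The permutation which interchanges the two parts of a concatenation. -/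
def braid : (l m : List C) → PermData (l ++ m) (m ++ l)
  | [], m => nilAppend m
  | a :: l, m => .cons (braid l m) (Insertion.middle a m l)

end PermData

/-! ### Action of permutations on tensor products in a symmetric monoidal category. -/

variable [SymmetricCategory E]

/-- The braiding of the first two of three tensor factors. -/
def swapFirst (a b X : E) : a ⊗ b ⊗ X ⟶ b ⊗ a ⊗ X :=
  (α_ a b X).inv ≫ (β_ a b).hom ▷ X ≫ (α_ b a X).hom

theorem swapFirst_natural (a b : E) {X Y : E} (f : X ⟶ Y) :
    a ◁ b ◁ f ≫ swapFirst a b Y = swapFirst a b X ≫ b ◁ a ◁ f := by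
  simp only [swapFirst, Category.assoc, associator_inv_naturality_right_assoc,
    whisker_exchange_assoc, associator_naturality_right]

theorem swapFirst_natural_assoc (a b : E) {X Y Z : E} (f : X ⟶ Y) (h : b ⊗ a ⊗ Y ⟶ Z) :
    a ◁ b ◁ f ≫ swapFirst a b Y ≫ h = swapFirst a b X ≫ b ◁ a ◁ f ≫ h := by
  rw [reassoc_of% swapFirst_natural a b f]

@[simp]
theorem swapFirst_swapFirst (a b X : E) : swapFirst a b X ≫ swapFirst b a X = 𝟙 _ := by
  simp [swapFirst, ← comp_whiskerRight_assoc]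

@[simp]
theorem swapFirst_swapFirst_assoc (a b X : E) {Z : E} (h : a ⊗ b ⊗ X ⟶ Z) :
    swapFirst a b X ≫ swapFirst b a X ≫ h = h := by
  rw [← Category.assoc, swapFirst_swapFirst, Category.id_comp]

/-- This is the Yang–Baxter equation of the braiding, whiskered with `X` and conjugated with
associators. -/
theorem swapFirst_yangBaxter (a b c X : E) :
    a ◁ swapFirst b c X ≫ swapFirst a c (b ⊗ X) ≫ c ◁ swapFirst a b X =
      swapFirst a b (c ⊗ X) ≫ b ◁ swapFirst a c X ≫ swapFirst b c (a ⊗ X) := by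
  have h := congrArg (fun t : (a ⊗ b ⊗ c ⟶ c ⊗ b ⊗ a) => (α_ a b (c ⊗ X)).inv ≫
    (α_ (a ⊗ b) c X).inv ≫ (α_ a b c).hom ▷ X ≫ t ▷ X ≫
    (α_ c (b ⊗ a) X).hom ≫ c ◁ (α_ b a X).hom) (BraidedCategory.yang_baxter a b c)
  simp only [swapFirst]
  convert h.symm using 1 <;> monoidal

theorem swapFirst_yangBaxter_assoc (a b c X : E) {Z : E} (h : c ⊗ b ⊗ a ⊗ X ⟶ Z) :
    a ◁ swapFirst b c X ≫ swapFirst a c (b ⊗ X) ≫ c ◁ swapFirst a b X ≫ h =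
      swapFirst a b (c ⊗ X) ≫ b ◁ swapFirst a c X ≫ swapFirst b c (a ⊗ X) ≫ h := by
  rw [reassoc_of% swapFirst_yangBaxter a b c X]

/-! Compatibilities of `swapFirst` with morphisms out of tensor products. -/

/-- Inductive step of `Insertion.exchange_hom`: `c` is the common head of the lists and `h` is the
induction hypothesis for the tails. Naturality moves `h` past `c`, and Yang–Baxter does the rest.
The next three lemmas are the inductive steps of `Insertion.append_hom`, `Insertion.middle_hom` and
`PermData.braid_hom`. All four use arbitrary objects of `E`, because `listTensor` of a cons is a
tensor product only after unfolding. -/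
theorem swapFirst_exchange {a b c L M N K : E} {i : a ⊗ L ⟶ M} {j : b ⊗ M ⟶ N} {i' : b ⊗ L ⟶ K}
    {j' : a ⊗ K ⟶ N} (h : b ◁ i ≫ j = swapFirst b a L ≫ a ◁ i' ≫ j') :
    b ◁ (swapFirst a c L ≫ c ◁ i) ≫ swapFirst b c M ≫ c ◁ j =
      swapFirst b a (c ⊗ L) ≫ a ◁ (swapFirst b c L ≫ c ◁ i') ≫ swapFirst a c K ≫ c ◁ j' := by
  simp only [MonoidalCategory.whiskerLeft_comp, Category.assoc]
  rw [swapFirst_natural_assoc, ← MonoidalCategory.whiskerLeft_comp, h]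
  simp only [MonoidalCategory.whiskerLeft_comp]
  rw [swapFirst_natural_assoc, ← swapFirst_yangBaxter_assoc]

theorem swapFirst_append {a b L L' M N N' : E} {i : a ⊗ L ⟶ L'} {t : L ⊗ M ⟶ N} {t' : L' ⊗ M ⟶ N'}
    {j : a ⊗ N ⟶ N'} (h : i ▷ M ≫ t' = (α_ a L M).hom ≫ a ◁ t ≫ j) :
    (swapFirst a b L ≫ b ◁ i) ▷ M ≫ (α_ b L' M).hom ≫ b ◁ t' =
      (α_ a (b ⊗ L) M).hom ≫ a ◁ ((α_ b L M).hom ≫ b ◁ t) ≫ swapFirst a b N ≫ b ◁ j := by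
  have h' := congrArg (fun t => b ◁ t) h
  simp only [MonoidalCategory.whiskerLeft_comp] at h'
  simp only [comp_whiskerRight, Category.assoc, associator_naturality_middle_assoc, h',
    MonoidalCategory.whiskerLeft_comp]
  rw [swapFirst_natural_assoc]
  simp only [← Category.assoc]
  congr 2
  simp only [swapFirst]
  monoidal

theorem swapFirst_braiding {a b L M : E} {N N' : E} {t : L ⊗ M ⟶ N} {t' : L ⊗ a ⊗ M ⟶ N'}
    {j : a ⊗ N ⟶ N'} (h : a ◁ t ≫ j = (swapFirst a L M) ≫ t') :
    a ◁ ((α_ b L M).hom ≫ b ◁ t) ≫ swapFirst a b N ≫ b ◁ j =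
      swapFirst a (b ⊗ L) M ≫ (α_ b L (a ⊗ M)).hom ≫ b ◁ t' := by
  simp only [MonoidalCategory.whiskerLeft_comp, Category.assoc]
  rw [swapFirst_natural_assoc, ← MonoidalCategory.whiskerLeft_comp, h,
    MonoidalCategory.whiskerLeft_comp]
  simp only [← Category.assoc]
  congr 1
  simp only [swapFirst, BraidedCategory.braiding_tensor_right_hom]
  monoidal

theorem braiding_swapFirst {a L M N N' P : E} {t : L ⊗ M ⟶ N} {t' : M ⊗ L ⟶ N'}
    {t'' : M ⊗ a ⊗ L ⟶ P} {b : N ⟶ N'} {j : a ⊗ N' ⟶ P} (h : t ≫ b = (β_ L M).hom ≫ t')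
    (h' : a ◁ t' ≫ j = swapFirst a M L ≫ t'') :
    ((α_ a L M).hom ≫ a ◁ t) ≫ a ◁ b ≫ j = (β_ (a ⊗ L) M).hom ≫ t'' := by
  rw [Category.assoc, ← MonoidalCategory.whiskerLeft_comp_assoc, h]
  simp only [MonoidalCategory.whiskerLeft_comp, Category.assoc, h']
  simp only [← Category.assoc]
  congr 1
  simp only [swapFirst, BraidedCategory.braiding_tensor_left_hom]
  monoidal

namespace Insertion

/-- The morphism which inserts a tensor factor. -/
def hom (V : C → E) {a : C} : {l l' : List C} → Insertion a l l' →
    (V a ⊗ listTensor V l ⟶ listTensor V l')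
  | _, _, .here _ => 𝟙 _
  | _, _, .there b i => swapFirst (V a) (V b) _ ≫ V b ◁ i.hom V

theorem exchange_hom (V : C → E) {a b : C} : {l m n : List C} → (i : Insertion a l m) →
    (j : Insertion b m n) → V b ◁ i.hom V ≫ j.hom V =
      swapFirst (V b) (V a) _ ≫ V a ◁ (i.exchange j).2.1.hom V ≫ (i.exchange j).2.2.hom V
  | l, m, _, i, .here _ => by
    -- The goal is restated with `listTensor` and `hom` unfolded, so that rewriting sees the tensor
    -- products; the two forms agree definitionally. The same device recurs below.
    have : V b ◁ i.hom V ≫ 𝟙 (V b ⊗ listTensor V m) = swapFirst (V b) (V a) (listTensor V l) ≫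
        V a ◁ 𝟙 (V b ⊗ listTensor V l) ≫ swapFirst (V a) (V b) _ ≫ V b ◁ i.hom V := by simp
    cases i <;> exact this
  | l, _, _, .here _, .there (l' := n) _ j => by
    have : V b ◁ 𝟙 (V a ⊗ listTensor V l) ≫ swapFirst (V b) (V a) _ ≫ V a ◁ j.hom V =
        swapFirst (V b) (V a) _ ≫ V a ◁ j.hom V ≫ 𝟙 (V a ⊗ listTensor V n) := by simp
    exact this
  | _, _, _, .there _ i, .there _ j => swapFirst_exchange (exchange_hom V i j)

theorem append_hom (V : C → E) {a : C} : {l l' : List C} → (i : Insertion a l l') → (m : List C) →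
    i.hom V ▷ listTensor V m ≫ (listTensorAppend V l' m).hom =
      (α_ _ _ _).hom ≫ V a ◁ (listTensorAppend V l m).hom ≫ (i.append m).hom V
  | _, _, .here l, m => by
    have : 𝟙 (V a ⊗ listTensor V l) ▷ listTensor V m ≫ (α_ _ _ _).hom ≫
        V a ◁ (listTensorAppend V l m).hom = (α_ _ _ _).hom ≫
          V a ◁ (listTensorAppend V l m).hom ≫ 𝟙 (V a ⊗ listTensor V (l ++ m)) := by simp
    exact this
  | _, _, .there b i, m => swapFirst_append (append_hom V i m)

theorem middle_hom (V : C → E) (a : C) : (l m : List C) →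
    V a ◁ (listTensorAppend V l m).hom ≫ (middle a l m).hom V =
      swapFirst (V a) (listTensor V l) (listTensor V m) ≫ (listTensorAppend V l (a :: m)).hom
  | [], m => by
    have : V a ◁ (λ_ (listTensor V m)).hom ≫ 𝟙 (V a ⊗ listTensor V m) =
        swapFirst (V a) (𝟙_ E) (listTensor V m) ≫ (λ_ (V a ⊗ listTensor V m)).hom := by
      simp [swapFirst]
    exact this
  | _ :: l, m => swapFirst_braiding (middle_hom V a l m)

end Insertion

namespace PermData

/-- The morphism which permutes tensor factors. -/
def hom (V : C → E) : {l l' : List C} → PermData l l' → (listTensor V l ⟶ listTensor V l')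
  | _, _, .nil => 𝟙 _
  | a :: _, _, .cons p i => V a ◁ p.hom V ≫ i.hom V

theorem refl_hom (V : C → E) : (l : List C) → (refl l).hom V = 𝟙 (listTensor V l)
  | [] => rfl
  | a :: l => by
    have : V a ◁ (refl l).hom V ≫ 𝟙 (V a ⊗ listTensor V l) = 𝟙 _ := by simp [refl_hom V l]
    exact this

/-- Correctness of `extract`: inserting `a` and then permuting is the same as permuting the other
factors and then inserting `a` at its final position. This brings a composite of permutations back
to normal form. -/
theorem extract_hom (V : C → E) {a : C} : {l m n : List C} → (i : Insertion a l m) →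
    (q : PermData m n) →
    i.hom V ≫ q.hom V = V a ◁ (q.extract i).2.1.hom V ≫ (q.extract i).2.2.hom V
  | _, _, _, .here l, .cons p i => Category.id_comp _
  | _, _, n, .there (l := l₀) (l' := l') b i, .cons (m := m) p j => by
    have h := extract_hom V i p
    have h' := Insertion.exchange_hom V (p.extract i).2.2 j
    have : (swapFirst (V a) (V b) (listTensor V l₀) ≫ V b ◁ i.hom V) ≫ V b ◁ p.hom V ≫ j.hom V =
        V a ◁ (V b ◁ (p.extract i).2.1.hom V ≫ ((p.extract i).2.2.exchange j).2.1.hom V) ≫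
          ((p.extract i).2.2.exchange j).2.2.hom V := by
      rw [Category.assoc, ← MonoidalCategory.whiskerLeft_comp_assoc, h,
        MonoidalCategory.whiskerLeft_comp, Category.assoc, h', swapFirst_natural_assoc,
        ← swapFirst_natural_assoc, ← swapFirst_natural_assoc, swapFirst_swapFirst_assoc,
        MonoidalCategory.whiskerLeft_comp, Category.assoc]
    exact this

theorem comp_hom (V : C → E) : {l m n : List C} → (p : PermData l m) → (q : PermData m n) →
    (p.comp q).hom V = p.hom V ≫ q.hom V
  | _, _, _, .nil, q => (Category.id_comp _).symm
  | a :: l, _, n, .cons (m := m) p i, q => by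
    have h := comp_hom V p (q.extract i).2.1
    have h' := extract_hom V i q
    have : V a ◁ (p.comp (q.extract i).2.1).hom V ≫ (q.extract i).2.2.hom V =
        (V a ◁ p.hom V ≫ i.hom V) ≫ q.hom V := by
      rw [h, Category.assoc, h', MonoidalCategory.whiskerLeft_comp, Category.assoc]
    exact this

theorem append_hom (V : C → E) : {l l' m m' : List C} → (p : PermData l l') → (q : PermData m m') →
    (p.hom V ⊗ₘ q.hom V) ≫ (listTensorAppend V l' m').hom =
      (listTensorAppend V l m).hom ≫ (p.append q).hom V
  | _, _, m, m', .nil, q => by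
    have : (𝟙 (𝟙_ E) ⊗ₘ q.hom V) ≫ (λ_ (listTensor V m')).hom =
      (λ_ (listTensor V m)).hom ≫ q.hom V := by simp
    exact this
  | a :: l, l', m, m', .cons (m := n) p i, q => by
    have h := append_hom V p q
    have h' := Insertion.append_hom V i m'
    have : ((V a ◁ p.hom V ≫ i.hom V) ⊗ₘ q.hom V) ≫ (listTensorAppend V l' m').hom =
        ((α_ (V a) (listTensor V l) (listTensor V m)).hom ≫ V a ◁ (listTensorAppend V l m).hom) ≫
          V a ◁ (p.append q).hom V ≫ (i.append m').hom V := by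
      rw [Category.assoc, ← MonoidalCategory.whiskerLeft_comp_assoc, ← h, tensorHom_def']
      simp only [comp_whiskerRight, Category.assoc, h', MonoidalCategory.whiskerLeft_comp,
        tensorHom_def', associator_naturality_middle_assoc, associator_naturality_right_assoc]
    exact this

/-- Concatenation is not strictly associative or right unital by definition, so the associator and
the right unitor are matched with explicit identity permutations instead of casts along equalities
of lists. -/
theorem assoc_hom (V : C → E) : (l m n : List C) →
    (listTensorAppend V l m).hom ▷ listTensor V n ≫ (listTensorAppend V (l ++ m) n).hom ≫
      (assoc l m n).hom V = (α_ _ _ _).hom ≫ listTensor V l ◁ (listTensorAppend V m n).hom ≫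
        (listTensorAppend V l (m ++ n)).hom
  | [], m, n => by
    have : (λ_ (listTensor V m)).hom ▷ listTensor V n ≫ (listTensorAppend V m n).hom ≫
        (refl (m ++ n)).hom V = (α_ (𝟙_ E) _ _).hom ≫ 𝟙_ E ◁ (listTensorAppend V m n).hom ≫
          (λ_ (listTensor V (m ++ n))).hom := by
      simp [refl_hom]
    exact this
  | a :: l, m, n => by
    have h := congrArg (fun t => V a ◁ t) (assoc_hom V l m n)
    simp only [MonoidalCategory.whiskerLeft_comp] at h
    have : ((α_ (V a) (listTensor V l) (listTensor V m)).hom ≫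
        V a ◁ (listTensorAppend V l m).hom) ▷ listTensor V n ≫
        ((α_ _ _ _).hom ≫ V a ◁ (listTensorAppend V (l ++ m) n).hom) ≫
        V a ◁ (assoc l m n).hom V ≫ 𝟙 (V a ⊗ listTensor V (l ++ (m ++ n))) =
        (α_ (V a ⊗ listTensor V l) _ _).hom ≫
        (V a ⊗ listTensor V l) ◁ (listTensorAppend V m n).hom ≫
        (α_ _ _ _).hom ≫ V a ◁ (listTensorAppend V l (m ++ n)).hom := by
      simp [h]
    exact this

theorem appendNil_hom (V : C → E) : (l : List C) →
    (listTensorAppend V l []).hom ≫ (appendNil l).hom V = (ρ_ (listTensor V l)).hom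
  | [] => by
    have : (λ_ (𝟙_ E)).hom ≫ 𝟙 _ = (ρ_ (𝟙_ E)).hom := by simp [unitors_equal]
    exact this
  | a :: l => by
    have (X Y L : E) (t : L ⊗ 𝟙_ E ⟶ Y) (t' : Y ⟶ L) (h : t ≫ t' = (ρ_ L).hom) :
        ((α_ X L (𝟙_ E)).hom ≫ X ◁ t) ≫ X ◁ t' ≫ 𝟙 (X ⊗ L) = (ρ_ (X ⊗ L)).hom := by
      rw [Category.comp_id, Category.assoc, ← MonoidalCategory.whiskerLeft_comp, h]
      simp
    exact this _ _ _ _ _ (appendNil_hom V l)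

theorem nilAppend_hom (V : C → E) : (l : List C) →
    (nilAppend l).hom V = (ρ_ (listTensor V l)).inv ≫ (listTensorAppend V l []).hom
  | [] => by
    have : 𝟙 _ = (ρ_ (𝟙_ E)).inv ≫ (λ_ (𝟙_ E)).hom := by simp [unitors_equal]
    exact this
  | a :: l => by
    have (X Y L : E) (t : L ⊗ 𝟙_ E ⟶ Y) (t' : L ⟶ Y) (h : t' = (ρ_ L).inv ≫ t) :
        X ◁ t' ≫ 𝟙 (X ⊗ Y) = (ρ_ (X ⊗ L)).inv ≫ (α_ X L (𝟙_ E)).hom ≫ X ◁ t := by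
      simp [h]
    exact this _ _ _ _ _ (nilAppend_hom V l)

/-- By the hexagon identity, braiding `a :: l` past `m` amounts to braiding `l` past `m` and then
moving `a` past `m`, which is an insertion in the middle. -/
theorem braid_hom (V : C → E) : (l m : List C) →
    (listTensorAppend V l m).hom ≫ (braid l m).hom V =
      (β_ _ _).hom ≫ (listTensorAppend V m l).hom
  | [], m => by
    have : (λ_ (listTensor V m)).hom ≫ (nilAppend m).hom V =
        (β_ (𝟙_ E) (listTensor V m)).hom ≫ (listTensorAppend V m []).hom := by
      rw [nilAppend_hom, braiding_tensorUnit_left]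
      exact (Category.assoc _ _ _).symm
    exact this
  | a :: l, m => braiding_swapFirst (braid_hom V l m) (Insertion.middle_hom V a m l)

end PermData

end ListTensor

/-! ## Freely generated symmetric monoidal categories -/

section FreelyGenerated

open Functor.LaxMonoidal Functor.OplaxMonoidal Functor.Monoidal

universe z v'' u''

variable {C : Type z}
variable {B : Type u'} [Category.{v'} B] [MonoidalCategory B] [SymmetricCategory B]
variable {E : Type u} [Category.{v} E] [MonoidalCategory E] [SymmetricCategory E]

/-- A braided functor carries tensor products of lists to tensor products of lists. -/
def listTensorCompare (F : B ⥤ E) [F.Braided] {p : C → B} {V : C → E}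
    (a : ∀ c, F.obj (p c) ⟶ V c) : (l : List C) → (F.obj (listTensor p l) ⟶ listTensor V l)
  | [] => η F
  | c :: l => δ F (p c) (listTensor p l) ≫ (a c ⊗ₘ listTensorCompare F a l)

theorem isIso_listTensorCompare (F : B ⥤ E) [F.Braided] {p : C → B} {V : C → E}
    (a : ∀ c, F.obj (p c) ⟶ V c) [∀ c, IsIso (a c)] :
    (l : List C) → IsIso (listTensorCompare F a l)
  | [] => inferInstanceAs (IsIso (η F))
  | c :: l => by
    have := isIso_listTensorCompare F a l
    exact inferInstanceAs (IsIso (δ F (p c) (listTensor p l) ≫ (a c ⊗ₘ listTensorCompare F a l)))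

theorem swapFirst_natural' {x y z x' y' z' : E} (f : x ⟶ x') (g : y ⟶ y') (h : z ⟶ z') :
    swapFirst x y z ≫ (g ⊗ₘ f ⊗ₘ h) = (f ⊗ₘ g ⊗ₘ h) ≫ swapFirst x' y' z' := by
  simp only [swapFirst, Category.assoc, ← associator_naturality, associator_inv_naturality_assoc]
  simp only [← tensorHom_id, tensorHom_comp_tensorHom_assoc, Category.id_comp, Category.comp_id,
    BraidedCategory.braiding_naturality]

/-- A braided functor preserves associators and braidings, hence `swapFirst`; cancelling the
invertible `μ` turns the claim into these two facts. -/
theorem map_swapFirst_comp (F : B ⥤ E) [F.Braided] (x y z : B) :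
    F.map (swapFirst x y z) ≫ δ F y (x ⊗ z) ≫ F.obj y ◁ δ F x z =
      δ F x (y ⊗ z) ≫ F.obj x ◁ δ F y z ≫ swapFirst (F.obj x) (F.obj y) (F.obj z) := by
  rw [← cancel_epi (μ F x (y ⊗ z)), ← cancel_epi (F.obj x ◁ μ F y z)]
  simp only [swapFirst, F.map_comp, Category.assoc, whiskerLeft_μ_comp_μ_assoc,
    Iso.map_hom_inv_id_assoc, μ_δ_assoc, whiskerLeft_μ_δ_assoc]
  rw [← μ_natural_left_assoc, F.map_braiding]
  simp only [comp_whiskerRight, Category.assoc, Category.comp_id, map_associator, μ_δ_assoc,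
    whiskerRight_μ_δ_assoc, whiskerLeft_μ_δ]

theorem Insertion.map_hom_comp (F : B ⥤ E) [F.Braided] {p : C → B} {V : C → E}
    (a : ∀ c, F.obj (p c) ⟶ V c) {c : C} : {l l' : List C} → (i : Insertion c l l') →
    F.map (i.hom p) ≫ listTensorCompare F a l' =
      (δ F (p c) (listTensor p l) ≫ (a c ⊗ₘ listTensorCompare F a l)) ≫ i.hom V
  | _, _, .here l => by
    have : F.map (𝟙 (p c ⊗ listTensor p l)) ≫ δ F _ _ ≫ (a c ⊗ₘ listTensorCompare F a l) =
      (δ F _ _ ≫ (a c ⊗ₘ listTensorCompare F a l)) ≫ 𝟙 _ := by simp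
    exact this
  | _, _, .there d (l := l) (l' := l') i => by
    have h := Insertion.map_hom_comp F a i
    have : F.map (swapFirst (p c) (p d) (listTensor p l) ≫ p d ◁ i.hom p) ≫ δ F _ _ ≫
        (a d ⊗ₘ listTensorCompare F a l') = (δ F _ _ ≫ (a c ⊗ₘ (δ F _ _ ≫
          (a d ⊗ₘ listTensorCompare F a l)))) ≫ swapFirst _ _ _ ≫ V d ◁ i.hom V := by
      rw [F.map_comp, Category.assoc, ← δ_natural_right_assoc]
      have h' : F.obj (p d) ◁ F.map (i.hom p) ≫ (a d ⊗ₘ listTensorCompare F a l') =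
          (F.obj (p d)) ◁ δ F _ _ ≫ (a d ⊗ₘ (a c ⊗ₘ listTensorCompare F a l)) ≫
            V d ◁ i.hom V := by
        rw [← id_tensorHom, tensorHom_comp_tensorHom, h, ← id_tensorHom, ← id_tensorHom,
          tensorHom_comp_tensorHom, tensorHom_comp_tensorHom]
        simp
      have h₁ : (a c ⊗ₘ (δ F (p d) (listTensor p l) ≫ (a d ⊗ₘ listTensorCompare F a l))) =
          F.obj (p c) ◁ δ F _ _ ≫ (a c ⊗ₘ (a d ⊗ₘ listTensorCompare F a l)) := by
        rw [← id_tensorHom, tensorHom_comp_tensorHom, Category.id_comp]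
      rw [h', reassoc_of% map_swapFirst_comp, h₁]
      simp only [Category.assoc, reassoc_of% swapFirst_natural']
    exact this

/-- Permutations are built from structural morphisms only, so braided functors respect them. Both
the transfer of free generation and the naturality of transformations defined on generators rest on
this. -/
theorem PermData.map_hom_comp (F : B ⥤ E) [F.Braided] {p : C → B} {V : C → E}
    (a : ∀ c, F.obj (p c) ⟶ V c) : {l l' : List C} → (q : PermData l l') →
    F.map (q.hom p) ≫ listTensorCompare F a l' = listTensorCompare F a l ≫ q.hom V
  | _, _, .nil => by
    have : F.map (𝟙 (𝟙_ B)) ≫ η F = η F ≫ 𝟙 _ := by simp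
    exact this
  | c :: l, l', .cons (m := m) q i => by
    have h := PermData.map_hom_comp F a q
    have h' := Insertion.map_hom_comp F a i
    have : F.map (p c ◁ q.hom p ≫ i.hom p) ≫ listTensorCompare F a l' =
        (δ F _ _ ≫ (a c ⊗ₘ listTensorCompare F a l)) ≫ V c ◁ q.hom V ≫ i.hom V := by
      rw [F.map_comp, Category.assoc, h', ← Category.assoc, ← Category.assoc, ← Category.assoc]
      congr 1
      rw [← δ_natural_right, Category.assoc, Category.assoc, ← id_tensorHom, ← id_tensorHom,
        tensorHom_comp_tensorHom, tensorHom_comp_tensorHom, h]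
      simp
    exact this

theorem map_listTensorAppend_comp (F : B ⥤ E) [F.Braided] {p : C → B} {V : C → E}
    (a : ∀ c, F.obj (p c) ⟶ V c) : (l m : List C) →
    F.map (listTensorAppend p l m).hom ≫ listTensorCompare F a (l ++ m) =
      δ F _ _ ≫ (listTensorCompare F a l ⊗ₘ listTensorCompare F a m) ≫ (listTensorAppend V l m).hom
  | [], m => by
    have : F.map (λ_ (listTensor p m)).hom ≫ listTensorCompare F a m =
        δ F (𝟙_ B) (listTensor p m) ≫ (η F ⊗ₘ listTensorCompare F a m) ≫ (λ_ _).hom := by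
      rw [MonoidalCategory.tensorHom_def, Category.assoc, leftUnitor_naturality]
      simp
    exact this
  | c :: l, m => by
    have h := map_listTensorAppend_comp F a l m
    have : F.map ((α_ (p c) (listTensor p l) (listTensor p m)).hom ≫
        p c ◁ (listTensorAppend p l m).hom) ≫ δ F _ _ ≫ (a c ⊗ₘ listTensorCompare F a (l ++ m)) =
        δ F _ _ ≫ ((δ F _ _ ≫ (a c ⊗ₘ listTensorCompare F a l)) ⊗ₘ listTensorCompare F a m) ≫
          (α_ (V c) (listTensor V l) (listTensor V m)).hom ≫
          V c ◁ (listTensorAppend V l m).hom := by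
      rw [F.map_comp, Category.assoc, ← δ_natural_right_assoc, ← id_tensorHom,
        tensorHom_comp_tensorHom, h]
      have h₁ : (𝟙 (F.obj (p c)) ≫ a c ⊗ₘ δ F (listTensor p l) (listTensor p m) ≫
            (listTensorCompare F a l ⊗ₘ listTensorCompare F a m) ≫ (listTensorAppend V l m).hom) =
          F.obj (p c) ◁ δ F _ _ ≫
            (a c ⊗ₘ (listTensorCompare F a l ⊗ₘ listTensorCompare F a m)) ≫
              V c ◁ (listTensorAppend V l m).hom := by
        rw [← id_tensorHom, ← id_tensorHom, tensorHom_comp_tensorHom, tensorHom_comp_tensorHom]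
        simp
      have h₂ : (δ F (p c) (listTensor p l) ≫ (a c ⊗ₘ listTensorCompare F a l)) ⊗ₘ
          listTensorCompare F a m = δ F _ _ ▷ F.obj (listTensor p m) ≫
            ((a c ⊗ₘ listTensorCompare F a l) ⊗ₘ listTensorCompare F a m) := by
        rw [← tensorHom_id, tensorHom_comp_tensorHom, Category.id_comp]
      rw [h₁, h₂, ← Functor.OplaxMonoidal.associativity_assoc]
      simp
    exact this

/-- The objects `p c` freely generate the symmetric monoidal category `B`: the morphisms between
their tensor products are the permutations, and every object is isomorphic to such a tensor
product. -/
structure FreelyGenerates (p : C → B) : Prop where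
  bijective (l l' : List C) :
    Function.Bijective fun q : PermData l l' => (q.hom p : listTensor p l ⟶ listTensor p l')
  exists_iso (X : B) : ∃ l, Nonempty (listTensor p l ≅ X)

namespace FreelyGenerates

/-- Conjugation with the comparison isomorphisms identifies the morphisms between tensor products of
the `p c` with those between tensor products of the `p' c`. Essential surjectivity of `F` need not
be assumed: an isomorphism from a tensor product of generators to `F.obj X` lifts through `F`. -/
theorem of_fullyFaithful {B' : Type u''} [Category.{v''} B'] [MonoidalCategory B']
    [SymmetricCategory B'] {p' : C → B'} (h : FreelyGenerates p') (F : B ⥤ B') [F.Braided]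
    [F.Full] [F.Faithful] {p : C → B} (e : ∀ c, F.obj (p c) ≅ p' c) : FreelyGenerates p where
  bijective l l' := by
    have := isIso_listTensorCompare F (fun c => (e c).hom)
    refine ⟨fun q q' hq => (h.bijective l l').1 ?_, fun σ => ?_⟩
    · have h₁ := q.map_hom_comp F (fun c => (e c).hom)
      have h₂ := q'.map_hom_comp F (fun c => (e c).hom)
      dsimp only at hq
      rw [hq, h₂] at h₁
      exact ((cancel_epi _).1 h₁).symm
    · obtain ⟨q, hq⟩ := (h.bijective l l').2 (inv (listTensorCompare F (fun c => (e c).hom) l) ≫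
        F.map σ ≫ listTensorCompare F (fun c => (e c).hom) l')
      refine ⟨q, F.map_injective ?_⟩
      have h₁ := q.map_hom_comp F (fun c => (e c).hom)
      dsimp only at hq
      rw [hq, IsIso.hom_inv_id_assoc] at h₁
      exact (cancel_mono _).1 h₁
  exists_iso X := by
    obtain ⟨l, ⟨f⟩⟩ := h.exists_iso (F.obj X)
    have := isIso_listTensorCompare F (fun c => (e c).hom) l
    exact ⟨l, ⟨F.preimageIso (asIso (listTensorCompare F (fun c => (e c).hom) l) ≪≫ f)⟩⟩

/-- Monoidal natural transformations are determined by arbitrary values on free generators. -/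
theorem exists_natTrans {p : C → B} (h : FreelyGenerates p) (F G : B ⥤ E) [F.Braided] [G.Braided]
    (a : ∀ c, F.obj (p c) ⟶ G.obj (p c)) :
    ∃ α : F ⟶ G, NatTrans.IsMonoidal α ∧ ∀ c, α.app (p c) = a c := by
  -- This comparison splits `G` of a tensor product of generators into the tensor product of the
  -- `G.obj (p c)`. Its invertibility leaves only one candidate `b l` for the component at a list.
  have hG := isIso_listTensorCompare G (p := p) (fun c => 𝟙 (G.obj (p c)))
  obtain ⟨b, hbc⟩ : ∃ b : ∀ l, F.obj (listTensor p l) ⟶ G.obj (listTensor p l),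
      ∀ l, b l ≫ listTensorCompare G (fun c => 𝟙 (G.obj (p c))) l = listTensorCompare F a l :=
    ⟨fun l => listTensorCompare F a l ≫ inv (listTensorCompare G (fun c => 𝟙 (G.obj (p c))) l),
      fun l => by simp⟩
  -- Here freeness is used: every such `f` is a permutation, and permutations commute with the
  -- comparison maps.
  have hb {l l' : List C} (f : listTensor p l ⟶ listTensor p l') :
      F.map f ≫ b l' = b l ≫ G.map f := by
    obtain ⟨q, rfl⟩ := (h.bijective l l').2 f
    dsimp only
    rw [← cancel_mono (listTensorCompare G (fun c => 𝟙 (G.obj (p c))) l'), Category.assoc,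
      Category.assoc, hbc, q.map_hom_comp F, q.map_hom_comp G, reassoc_of% hbc]
  choose l e using h.exists_iso
  let u (X : B) : listTensor p (l X) ≅ X := (e X).some
  let α : F ⟶ G :=
    { app X := F.map (u X).inv ≫ b (l X) ≫ G.map (u X).hom
      naturality X Y f := by
        have := hb ((u X).hom ≫ f ≫ (u Y).inv)
        simp only [F.map_comp, G.map_comp, Category.assoc] at this
        rw [← cancel_epi (F.map (u X).hom), reassoc_of% this]
        simp }
  -- The component at `X` can be computed from any presentation of `X`, not just the chosen one. The
  -- unit, tensor products and generators are treated by presenting them as `[]`, a concatenation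
  -- and `[c]`.
  have hα {X : B} {m : List C} (f : listTensor p m ≅ X) :
      α.app X = F.map f.inv ≫ b m ≫ G.map f.hom := by
    have := hb (f.hom ≫ (u X).inv)
    rw [F.map_comp, G.map_comp, Category.assoc] at this
    rw [← cancel_epi (F.map f.hom)]
    dsimp only [α]
    rw [reassoc_of% this]
    simp
  refine ⟨α, ⟨?_, fun X Y => ?_⟩, fun c => ?_⟩
  · have key (f : F.obj (𝟙_ B) ⟶ G.obj (𝟙_ B)) (hf : f ≫ η G = η F) :
        ε F ≫ F.map (𝟙 _) ≫ f ≫ G.map (𝟙 _) = ε G := by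
      rw [← cancel_mono (η G)]
      simp [hf]
    rw [← key _ (hbc [])]
    exact congrArg (ε F ≫ ·) (hα (m := []) (Iso.refl (𝟙_ B)))
  · have h₁ (l m : List C) : μ F _ _ ≫ F.map (listTensorAppend p l m).hom ≫ b (l ++ m) =
        (b l ⊗ₘ b m) ≫ μ G _ _ ≫ G.map (listTensorAppend p l m).hom := by
      rw [← cancel_mono (listTensorCompare G (fun c => 𝟙 (G.obj (p c))) (l ++ m))]
      simp only [Category.assoc]
      rw [hbc, map_listTensorAppend_comp, map_listTensorAppend_comp, μ_δ_assoc, μ_δ_assoc,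
        tensorHom_comp_tensorHom_assoc, hbc, hbc]
    rw [hα ((listTensorAppend p (l X) (l Y)).symm ≪≫ (u X ⊗ᵢ u Y))]
    simp only [Iso.trans_inv, Iso.trans_hom, Iso.symm_hom, Iso.symm_inv, tensorIso_hom,
      tensorIso_inv, F.map_comp, G.map_comp, Category.assoc, ← μ_natural_assoc,
      reassoc_of% h₁, Iso.map_hom_inv_id_assoc]
    simp only [← μ_natural, tensorHom_comp_tensorHom_assoc, α]
  · have key (f : F.obj (p c ⊗ 𝟙_ B) ⟶ G.obj (p c ⊗ 𝟙_ B))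
        (hf : f ≫ δ G _ _ ≫ (𝟙 _ ⊗ₘ η G) = δ F _ _ ≫ (a c ⊗ₘ η F)) :
        F.map (ρ_ (p c)).inv ≫ f ≫ G.map (ρ_ (p c)).hom = a c := by
      rw [id_tensorHom] at hf
      rw [map_rightUnitor, reassoc_of% hf, ← cancel_epi (F.map (ρ_ (p c)).hom),
        Iso.map_hom_inv_id_assoc, map_rightUnitor, tensorHom_def']
      simp
    exact (hα (m := [c]) (ρ_ (p c))).trans (key _ (hbc [c]))

end FreelyGenerates

end FreelyGenerated

/-! ### Symmetric monoidal functors with prescribed values on free generators. -/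

section FreelyGenerated

open Functor.LaxMonoidal Functor.OplaxMonoidal Functor.Monoidal

universe z v'' u''

variable {C : Type z}
variable {B : Type u'} [Category.{v'} B] [MonoidalCategory B] [SymmetricCategory B]
variable {E : Type u} [Category.{v} E] [MonoidalCategory E] [SymmetricCategory E]

namespace PermData

variable {V : C → E} {l m n : List C} {e f g : E}

theorem assoc_hom_comp (a : listTensor V l ≅ e) (b : listTensor V m ≅ f) (c : listTensor V n ≅ g) :
    ((listTensorAppend V (l ++ m) n).inv ≫
        (((listTensorAppend V l m).inv ≫ (a.hom ⊗ₘ b.hom)) ⊗ₘ c.hom)) ≫ (α_ e f g).hom =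
      (assoc l m n).hom V ≫ (listTensorAppend V l (m ++ n)).inv ≫
        (a.hom ⊗ₘ ((listTensorAppend V m n).inv ≫ (b.hom ⊗ₘ c.hom))) := by
  have h := assoc_hom V l m n
  rw [Category.assoc, Iso.inv_comp_eq, ← cancel_epi ((listTensorAppend V l m).hom ▷ _),
    reassoc_of% h, Iso.hom_inv_id_assoc]
  simp only [← tensorHom_id, ← id_tensorHom, tensorHom_comp_tensorHom,
    tensorHom_comp_tensorHom_assoc, Iso.hom_inv_id_assoc, Category.id_comp, associator_naturality]

theorem refl_hom_comp (a : listTensor V l ≅ e) :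
    ((λ_ (listTensor V l)).inv ≫ (𝟙 (𝟙_ E) ⊗ₘ a.hom)) ≫ (λ_ e).hom =
      (refl l).hom V ≫ a.hom := by
  simp [refl_hom]

theorem appendNil_hom_comp (a : listTensor V l ≅ e) :
    ((listTensorAppend V l []).inv ≫ (a.hom ⊗ₘ 𝟙 (𝟙_ E))) ≫ (ρ_ e).hom =
      (appendNil l).hom V ≫ a.hom := by
  rw [Category.assoc, Iso.inv_comp_eq, ← Category.assoc, appendNil_hom]
  exact (tensorHom_id a.hom (𝟙_ E)).symm ▸ rightUnitor_naturality a.hom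

theorem braid_hom_comp (a : listTensor V l ≅ e) (b : listTensor V m ≅ f) :
    ((listTensorAppend V l m).inv ≫ (a.hom ⊗ₘ b.hom)) ≫ (β_ e f).hom =
      (braid l m).hom V ≫ (listTensorAppend V m l).inv ≫ (b.hom ⊗ₘ a.hom) := by
  have h := braid_hom V l m
  rw [Category.assoc, Iso.inv_comp_eq, reassoc_of% h, Iso.hom_inv_id_assoc,
    BraidedCategory.braiding_naturality]

end PermData

/-- A presentation of an object of `B` and an object of `E` as tensor products of the objects
indexed by the same list. -/
structure Presentation (p : C → B) (V : C → E) (x : B) (e : E) where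
  /-- The list. -/
  list : List C
  /-- The presentation of the object of `B`. -/
  left : listTensor p list ≅ x
  /-- The presentation of the object of `E`. -/
  right : listTensor V list ≅ e

namespace Presentation

variable {p : C → B} {V : C → E} {x y z x' y' : B} {e f g e' f' : E}

/-- Two morphisms correspond to each other if they are given by the same permutation. -/
def Corresponds (P : Presentation p V x e) (Q : Presentation p V y f) (s : x ⟶ y) (t : e ⟶ f) :
    Prop :=
  ∃ q : PermData P.list Q.list, P.left.hom ≫ s = q.hom p ≫ Q.left.hom ∧
    P.right.hom ≫ t = q.hom V ≫ Q.right.hom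

/-- The tensor product of presentations. -/
def tensor (P : Presentation p V x e) (Q : Presentation p V y f) :
    Presentation p V (x ⊗ y) (e ⊗ f) where
  list := P.list ++ Q.list
  left := (listTensorAppend p P.list Q.list).symm ≪≫ (P.left ⊗ᵢ Q.left)
  right := (listTensorAppend V P.list Q.list).symm ≪≫ (P.right ⊗ᵢ Q.right)

variable (p V) in
/-- The presentation of the unit objects. -/
def empty : Presentation p V (𝟙_ B) (𝟙_ E) := ⟨[], Iso.refl _, Iso.refl _⟩

variable (p V) in
/-- The presentation of a generator. -/
def generator (c : C) : Presentation p V (p c) (V c) := ⟨[c], ρ_ _, ρ_ _⟩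

namespace Corresponds

variable {P : Presentation p V x e} {Q : Presentation p V y f} {R : Presentation p V z g}
  {P' : Presentation p V x' e'} {Q' : Presentation p V y' f'}

/-- The morphism in `B` determines the permutation by freeness, and the permutation determines the
morphism in `E`. This is the coherence principle behind `lift`: an equation in `E` is deduced from
its counterpart `hs` in `B`. -/
theorem eq_right (h : FreelyGenerates p) {s s' : x ⟶ y} {t t' : e ⟶ f}
    (h₁ : Corresponds P Q s t) (h₂ : Corresponds P Q s' t') (hs : s = s') : t = t' := by
  subst hs
  obtain ⟨q, hq, hq'⟩ := h₁
  obtain ⟨r, hr, hr'⟩ := h₂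
  obtain rfl : q = r := (h.bijective _ _).1 ((cancel_mono Q.left.hom).1 (hq.symm.trans hr))
  exact (cancel_epi P.right.hom).1 (hq'.trans hr'.symm)

theorem exists_right (h : FreelyGenerates p) (P : Presentation p V x e) (Q : Presentation p V y f)
    (s : x ⟶ y) : ∃ t, Corresponds P Q s t := by
  obtain ⟨q, hq⟩ := (h.bijective _ _).2 (P.left.hom ≫ s ≫ Q.left.inv)
  dsimp only at hq
  exact ⟨P.right.inv ≫ q.hom V ≫ Q.right.hom, q, by simp [hq], by simp⟩

theorem id (P : Presentation p V x e) : Corresponds P P (𝟙 x) (𝟙 e) :=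
  ⟨PermData.refl _, by simp [PermData.refl_hom], by simp [PermData.refl_hom]⟩

theorem comp {s : x ⟶ y} {t : e ⟶ f} {s' : y ⟶ z} {t' : f ⟶ g} (h₁ : Corresponds P Q s t)
    (h₂ : Corresponds Q R s' t') : Corresponds P R (s ≫ s') (t ≫ t') := by
  obtain ⟨q, hq, hq'⟩ := h₁
  obtain ⟨r, hr, hr'⟩ := h₂
  exact ⟨q.comp r, by rw [reassoc_of% hq, hr, PermData.comp_hom, Category.assoc],
    by rw [reassoc_of% hq', hr', PermData.comp_hom, Category.assoc]⟩

theorem tensorHom {s : x ⟶ y} {t : e ⟶ f} {s' : x' ⟶ y'} {t' : e' ⟶ f'}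
    (h₁ : Corresponds P Q s t) (h₂ : Corresponds P' Q' s' t') :
    Corresponds (P.tensor P') (Q.tensor Q') (s ⊗ₘ s') (t ⊗ₘ t') := by
  obtain ⟨q, hq, hq'⟩ := h₁
  obtain ⟨r, hr, hr'⟩ := h₂
  have h₁ := PermData.append_hom p q r
  have h₂ := PermData.append_hom V q r
  refine ⟨q.append r, ?_, ?_⟩
  · simp only [tensor, Iso.trans_hom, Iso.symm_hom, tensorIso_hom, Category.assoc]
    rw [Iso.inv_comp_eq, ← reassoc_of% h₁]
    simp only [Iso.hom_inv_id_assoc, tensorHom_comp_tensorHom, hq, hr]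
  · simp only [tensor, Iso.trans_hom, Iso.symm_hom, tensorIso_hom, Category.assoc]
    rw [Iso.inv_comp_eq, ← reassoc_of% h₂]
    simp only [Iso.hom_inv_id_assoc, tensorHom_comp_tensorHom, hq', hr']

theorem associator (P : Presentation p V x e) (Q : Presentation p V y f)
    (R : Presentation p V z g) : Corresponds ((P.tensor Q).tensor R) (P.tensor (Q.tensor R))
      (α_ x y z).hom (α_ e f g).hom :=
  ⟨PermData.assoc _ _ _, PermData.assoc_hom_comp _ _ _, PermData.assoc_hom_comp _ _ _⟩

theorem leftUnitor (P : Presentation p V x e) :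
    Corresponds ((empty p V).tensor P) P (λ_ x).hom (λ_ e).hom :=
  ⟨PermData.refl _, PermData.refl_hom_comp _, PermData.refl_hom_comp _⟩

theorem rightUnitor (P : Presentation p V x e) :
    Corresponds (P.tensor (empty p V)) P (ρ_ x).hom (ρ_ e).hom :=
  ⟨PermData.appendNil _, PermData.appendNil_hom_comp _, PermData.appendNil_hom_comp _⟩

theorem braiding (P : Presentation p V x e) (Q : Presentation p V y f) :
    Corresponds (P.tensor Q) (Q.tensor P) (β_ x y).hom (β_ e f).hom :=
  ⟨PermData.braid _ _, PermData.braid_hom_comp _ _, PermData.braid_hom_comp _ _⟩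

end Corresponds

end Presentation

namespace FreelyGenerates

open Presentation

variable {p : C → B} (h : FreelyGenerates p) {V : C → E}

/-- Objects of `E` which are presented together with the same object of `B` are isomorphic. -/
noncomputable def liftIso {x : B} {e f : E} (P : Presentation p V x e) (Q : Presentation p V x f) :
    e ≅ f where
  hom := (Corresponds.exists_right h P Q (𝟙 x)).choose
  inv := (Corresponds.exists_right h Q P (𝟙 x)).choose
  hom_inv_id := Corresponds.eq_right h
    ((Corresponds.exists_right h P Q (𝟙 x)).choose_spec.comp
      (Corresponds.exists_right h Q P (𝟙 x)).choose_spec) (.id P) (Category.comp_id _)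
  inv_hom_id := Corresponds.eq_right h
    ((Corresponds.exists_right h Q P (𝟙 x)).choose_spec.comp
      (Corresponds.exists_right h P Q (𝟙 x)).choose_spec) (.id Q) (Category.comp_id _)

theorem liftIso_spec {x : B} {e f : E} (P : Presentation p V x e) (Q : Presentation p V x f) :
    Corresponds P Q (𝟙 x) (h.liftIso P Q).hom :=
  (Corresponds.exists_right h P Q (𝟙 x)).choose_spec

variable (V) in
/-- A chosen presentation. -/
noncomputable def presentation (x : B) :
    Presentation p V x (listTensor V (h.exists_iso x).choose) where
  list := (h.exists_iso x).choose
  left := (h.exists_iso x).choose_spec.some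
  right := Iso.refl _

variable (V) in
/-- The functor which sends the free generators to given objects. -/
noncomputable def lift : B ⥤ E where
  obj x := listTensor V (h.exists_iso x).choose
  map {x y} s :=
    (Corresponds.exists_right h (h.presentation V x) (h.presentation V y) s).choose
  -- Although the values on morphisms are chosen, they are unique by `eq_right`, hence functorial.
  map_id _ := Corresponds.eq_right h (Corresponds.exists_right h _ _ _).choose_spec (.id _) rfl
  map_comp _ _ := Corresponds.eq_right h (Corresponds.exists_right h _ _ _).choose_spec
    ((Corresponds.exists_right h _ _ _).choose_spec.comp
      (Corresponds.exists_right h _ _ _).choose_spec) rfl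

theorem lift_map_spec {x y : B} (s : x ⟶ y) :
    Corresponds (h.presentation V x) (h.presentation V y) s ((h.lift V).map s) :=
  (Corresponds.exists_right h (h.presentation V x) (h.presentation V y) s).choose_spec

variable (V) in
/-- The monoidal structure on `lift`. -/
noncomputable def liftCoreMonoidal : (h.lift V).CoreMonoidal where
  εIso := h.liftIso (.empty p V) (h.presentation V (𝟙_ B))
  μIso x y := h.liftIso ((h.presentation V x).tensor (h.presentation V y))
    (h.presentation V (x ⊗ y))
  -- Each axiom is proved by naming the morphisms of `B` to which its two sides correspond; the
  -- final `simp` checks that these are equal, all the `liftIso` lying over identities.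
  μIso_hom_natural_left s z := by
    rw [← tensorHom_id]
    exact ((h.lift_map_spec s).tensorHom (.id _) |>.comp (h.liftIso_spec _ _)).eq_right h
      ((h.liftIso_spec _ _).comp (h.lift_map_spec _)) (by simp)
  μIso_hom_natural_right z s := by
    rw [← id_tensorHom]
    exact ((Corresponds.id _).tensorHom (h.lift_map_spec s) |>.comp (h.liftIso_spec _ _)).eq_right
      h ((h.liftIso_spec _ _).comp (h.lift_map_spec _)) (by simp)
  associativity x y z := by
    rw [← tensorHom_id, ← id_tensorHom]
    exact (((h.liftIso_spec _ _).tensorHom (.id _)).comp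
      ((h.liftIso_spec _ _).comp (h.lift_map_spec _))).eq_right h ((Corresponds.associator _ _ _).comp
        (((Corresponds.id _).tensorHom (h.liftIso_spec _ _)).comp (h.liftIso_spec _ _))) (by simp)
  left_unitality x := by
    rw [← tensorHom_id]
    exact (Corresponds.leftUnitor _).eq_right h (((h.liftIso_spec _ _).tensorHom (.id _)).comp
      ((h.liftIso_spec _ _).comp (h.lift_map_spec _))) (by simp)
  right_unitality x := by
    rw [← id_tensorHom]
    exact (Corresponds.rightUnitor _).eq_right h (((Corresponds.id _).tensorHom
      (h.liftIso_spec _ _)).comp ((h.liftIso_spec _ _).comp (h.lift_map_spec _))) (by simp)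

noncomputable instance liftBraided : (h.lift V).Braided where
  toMonoidal := (h.liftCoreMonoidal V).toMonoidal
  braided x y :=
    ((h.liftIso_spec _ _).comp (h.lift_map_spec _)).eq_right h
      ((Corresponds.braiding _ _).comp (h.liftIso_spec _ _)) (by simp)

variable (V) in
/-- The functor `lift` sends the free generators to the given objects. -/
noncomputable def liftGenerator (c : C) : (h.lift V).obj (p c) ≅ V c :=
  h.liftIso (h.presentation V (p c)) (.generator p V c)

end FreelyGenerates

end FreelyGenerated

/-! ## The symmetric monoidal category of coloured finite sets and bijections -/

/-- A finite set whose elements have colours in `C`. -/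
structure ColoredSet (C : Type u) : Type (max u (w + 1)) where
  /-- The underlying set. -/
  carrier : Type w
  [finite : Finite carrier]
  /-- The colours of the elements. -/
  color : carrier → C

namespace ColoredSet

attribute [instance] ColoredSet.finite

variable {C : Type u}

/-- A morphism of coloured finite sets is a bijection which preserves the colours. -/
@[ext]
structure Hom (X Y : ColoredSet.{w} C) : Type w where
  /-- The underlying bijection. -/
  equiv : X.carrier ≃ Y.carrier
  color_equiv (x : X.carrier) : Y.color (equiv x) = X.color x

instance : Category (ColoredSet.{w} C) where
  Hom X Y := Hom X Y
  id X := ⟨Equiv.refl _, fun _ => rfl⟩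
  comp f g := ⟨f.equiv.trans g.equiv, fun x => (g.color_equiv _).trans (f.color_equiv x)⟩

@[ext]
theorem hom_ext {X Y : ColoredSet.{w} C} {f g : X ⟶ Y} (h : ∀ x, f.equiv x = g.equiv x) : f = g :=
  Hom.ext (Equiv.ext h)

theorem color_hom {X Y : ColoredSet.{w} C} (f : X ⟶ Y) (x : X.carrier) :
    Y.color (f.equiv x) = X.color x :=
  f.color_equiv x

/-- A colour preserving bijection is an isomorphism. -/
def isoMk {X Y : ColoredSet.{w} C} (e : X.carrier ≃ Y.carrier)
    (he : ∀ x, Y.color (e x) = X.color x) : X ≅ Y where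
  hom := ⟨e, he⟩
  inv := ⟨e.symm, fun y => by rw [← he, e.apply_symm_apply]⟩
  hom_inv_id := hom_ext fun x => e.symm_apply_apply x
  inv_hom_id := hom_ext fun x => e.apply_symm_apply x

instance {X Y : ColoredSet.{w} C} (f : X ⟶ Y) : IsIso f :=
  inferInstanceAs (IsIso (isoMk f.equiv f.color_equiv).hom)

/-- The tensor product is the disjoint union, the unit is the empty set. -/
instance : MonoidalCategoryStruct (ColoredSet.{w} C) where
  tensorObj X Y := ⟨X.carrier ⊕ Y.carrier, Sum.elim X.color Y.color⟩
  tensorHom f g := ⟨f.equiv.sumCongr g.equiv, by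
    rintro (x | x); exacts [f.color_equiv x, g.color_equiv x]⟩
  whiskerLeft X _ _ f := ⟨(Equiv.refl X.carrier).sumCongr f.equiv, by
    rintro (x | x); exacts [rfl, f.color_equiv x]⟩
  whiskerRight f X := ⟨f.equiv.sumCongr (Equiv.refl X.carrier), by
    rintro (x | x); exacts [f.color_equiv x, rfl]⟩
  tensorUnit := ⟨PEmpty.{w + 1}, fun x => x.elim⟩
  associator X Y Z := isoMk (Equiv.sumAssoc X.carrier Y.carrier Z.carrier) (by
    rintro ((_ | _) | _) <;> rfl)
  leftUnitor X := isoMk (Equiv.emptySum PEmpty.{w + 1} X.carrier) (by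
    rintro (x | _); exacts [x.elim, rfl])
  rightUnitor X := isoMk (Equiv.sumEmpty X.carrier PEmpty.{w + 1}) (by
    rintro (_ | x); exacts [rfl, x.elim])

instance : MonoidalCategory (ColoredSet.{w} C) where
  tensorHom_def _ _ := hom_ext (by rintro (_ | _) <;> rfl)
  id_tensorHom_id _ _ := hom_ext (by rintro (_ | _) <;> rfl)
  tensorHom_comp_tensorHom _ _ _ _ := hom_ext (by rintro (_ | _) <;> rfl)
  whiskerLeft_id _ _ := hom_ext (by rintro (_ | _) <;> rfl)
  id_whiskerRight _ _ := hom_ext (by rintro (_ | _) <;> rfl)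
  associator_naturality _ _ _ := hom_ext (by rintro ((_ | _) | _) <;> rfl)
  leftUnitor_naturality _ := hom_ext (by rintro (x | _); exacts [x.elim, rfl])
  rightUnitor_naturality _ := hom_ext (by rintro (_ | x); exacts [rfl, x.elim])
  pentagon _ _ _ _ := hom_ext (by rintro (((_ | _) | _) | _) <;> rfl)
  triangle _ _ := hom_ext (by rintro ((_ | x) | _); exacts [rfl, x.elim, rfl])

instance : SymmetricCategory (ColoredSet.{w} C) where
  braiding X Y := isoMk (Equiv.sumComm X.carrier Y.carrier) (by rintro (_ | _) <;> rfl)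
  braiding_naturality_right _ _ _ _ := hom_ext (by rintro (_ | _) <;> rfl)
  braiding_naturality_left _ _ := hom_ext (by rintro (_ | _) <;> rfl)
  hexagon_forward _ _ _ := hom_ext (by rintro ((_ | _) | _) <;> rfl)
  hexagon_reverse _ _ _ := hom_ext (by rintro (_ | _ | _) <;> rfl)
  symmetry _ _ := hom_ext (by rintro (_ | _) <;> rfl)

/-- The one-element set with a given colour. -/
def point (c : C) : ColoredSet.{w} C := ⟨PUnit.{w + 1}, fun _ => c⟩

/-- The element which is inserted. -/
def inserted {a : C} {l l' : List C} (i : Insertion a l l') :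
    (listTensor point.{w} l').carrier :=
  (i.hom point.{w}).equiv (Sum.inl PUnit.unit)

/-- An insertion into a fixed list `l'` is determined by the position of the new element. The
equality is heterogeneous since the inserted colour and the remaining list are determined only along
the way. -/
theorem inserted_injective {a b : C} {l m l' : List C} (i : Insertion a l l')
    (j : Insertion b m l') (h : inserted.{w} i = inserted j) : a = b ∧ l = m ∧ i ≍ j := by
  induction i generalizing m with
  | here l =>
    cases j with
    | here => exact ⟨rfl, rfl, HEq.rfl⟩
    | there c j => exact (Sum.inl_ne_inr h).elim
  | there c i ih =>
    cases j with
    | here => exact (Sum.inr_ne_inl h).elim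
    | there c j =>
      obtain ⟨rfl, rfl, h⟩ := ih j (Sum.inr_injective h)
      exact ⟨rfl, rfl, by rw [eq_of_heq h]⟩

theorem exists_inserted : (l' : List C) → (x : (listTensor point.{w} l').carrier) →
    ∃ (a : C) (l : List C) (i : Insertion a l l'), inserted i = x
  | [], x => PEmpty.elim x
  | a :: l', Sum.inl _ => ⟨a, l', .here l', rfl⟩
  | b :: l', Sum.inr x => by
    obtain ⟨a, l, i, rfl⟩ := exists_inserted l' x
    exact ⟨a, b :: l, .there b i, rfl⟩

/-- The image of the first point determines the last insertion; cancelling this bijection leaves the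
permutations of the tails. -/
theorem hom_point_injective {l l' : List C} (p q : PermData l l')
    (h : p.hom point.{w} = q.hom point) : p = q := by
  induction p with
  | nil => cases q; rfl
  | cons p i ih =>
    cases q with
    | cons q j =>
      have h' (x) := congrArg (fun f => f.equiv x) h
      obtain ⟨-, rfl, hij⟩ := inserted_injective i j (h' (Sum.inl PUnit.unit))
      obtain rfl := eq_of_heq hij
      rw [ih q (hom_ext fun x => Sum.inr_injective
        ((i.hom point.{w}).equiv.injective (h' (Sum.inr x))))]

/-- A bijection between disjoint unions which preserves the point of the first parts restricts
to a bijection between the second parts. -/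
theorem exists_whiskerLeft {a b : C} {X Y : ColoredSet.{w} C} (f : point a ⊗ X ⟶ point b ⊗ Y)
    (hf : f.equiv (Sum.inl PUnit.unit) = Sum.inl PUnit.unit) :
    ∃ g : X ⟶ Y, ∀ x, f.equiv (Sum.inr x) = Sum.inr (g.equiv x) := by
  have h (x : X.carrier) : ∃ y, f.equiv (Sum.inr x) = Sum.inr y := by
    rcases h : f.equiv (Sum.inr x) with y | y
    · exact (Sum.inr_ne_inl (f.equiv.injective (h.trans hf.symm))).elim
    · exact ⟨y, rfl⟩
  choose g hg using h
  have hg' : Function.Bijective g := by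
    refine ⟨fun x x' hx => Sum.inr_injective (f.equiv.injective ?_), fun y => ?_⟩
    · rw [hg, hg, hx]
    · obtain ⟨x | x, hx⟩ := f.equiv.surjective (Sum.inr y)
      · exact (Sum.inl_ne_inr (hf.symm.trans hx)).elim
      · exact ⟨x, Sum.inr_injective ((hg x).symm.trans hx)⟩
  exact ⟨⟨Equiv.ofBijective g hg', fun x =>
    (congrArg (point b ⊗ Y).color (hg x)).symm.trans (f.color_equiv (Sum.inr x))⟩, hg⟩

theorem hom_point_surjective : {l l' : List C} →
    (f : listTensor point.{w} l ⟶ listTensor point l') → ∃ p : PermData l l', p.hom point = f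
  | [], [], f => ⟨.nil, hom_ext fun x => PEmpty.elim x⟩
  | [], _ :: _, f => PEmpty.elim (f.equiv.symm (Sum.inl PUnit.unit))
  | a :: l, l', f => by
    obtain ⟨b, m, i, hi⟩ := exists_inserted l' (f.equiv (Sum.inl PUnit.unit))
    obtain rfl : b = a := (color_hom (i.hom point) (Sum.inl PUnit.unit)).symm.trans
      ((congrArg _ hi).trans (color_hom f (Sum.inl PUnit.unit)))
    -- After undoing the insertion at the image of the first point, the bijection fixes that point
    -- and restricts to the tails.
    have hf : f = (f ≫ inv (i.hom point)) ≫ i.hom point := by simp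
    obtain ⟨g, hg⟩ := exists_whiskerLeft (X := listTensor point l) (Y := listTensor point m)
      (f ≫ inv (i.hom point)) (by
        apply (i.hom point).equiv.injective
        exact (congrArg (fun f => f.equiv (Sum.inl PUnit.unit)) hf).symm.trans hi.symm)
    obtain ⟨p, rfl⟩ := hom_point_surjective g
    refine ⟨.cons p i, Eq.trans (hom_ext ?_) hf.symm⟩
    rintro (x | x)
    · exact hi.trans (congrArg (fun f => f.equiv (Sum.inl PUnit.unit)) hf)
    · exact congrArg (i.hom point).equiv (hg x).symm

theorem freelyGenerates_point : FreelyGenerates (point.{w} : C → ColoredSet.{w} C) where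
  bijective l l' := ⟨hom_point_injective, hom_point_surjective⟩
  exists_iso X := by
    refine Finite.induction_empty_option (P := fun X => ∀ (_ : Finite X) (c : X → C),
      ∃ l, Nonempty (listTensor point l ≅ ⟨X, c⟩)) ?_ ?_ ?_ X.carrier X.finite X.color
    · intro X Y e ih _ c
      obtain ⟨l, ⟨f⟩⟩ := ih (.of_equiv _ e.symm) (c ∘ e)
      have : Finite X := .of_equiv _ e.symm
      exact ⟨l, ⟨f ≪≫ isoMk e fun _ => rfl⟩⟩
    · exact fun _ c => ⟨[], ⟨isoMk (Equiv.refl _) fun x => x.elim⟩⟩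
    · intro X _ ih _ c
      obtain ⟨l, ⟨f⟩⟩ := ih inferInstance (c ∘ some)
      -- The new element `none` is the head of the list, hence on the left, whereas
      -- `Equiv.optionEquivSumPUnit` puts it on the right.
      refine ⟨c none :: l, ⟨whiskerLeftIso (point (c none)) f ≪≫
        isoMk ((Equiv.sumComm _ _).trans (Equiv.optionEquivSumPUnit _).symm) ?_⟩⟩
      rintro (x | x) <;> rfl

end ColoredSet

/-! ## The pointwise tensor product of braided functors -/

section TensorFunctor

variable {B : Type u'} [Category.{v'} B] [MonoidalCategory B]
variable {E : Type u} [Category.{v} E] [MonoidalCategory E] [SymmetricCategory E]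

open Functor.LaxMonoidal Functor.OplaxMonoidal Functor.Monoidal

/-- This makes the pointwise tensor product of braided functors braided. The symmetry of `E` enters:
the two sides differ by a double braiding of `X₁` and `Y₂`. -/
theorem tensorμ_braiding_tensor_braiding (X₁ X₂ Y₁ Y₂ : E) :
    tensorμ X₁ X₂ Y₁ Y₂ ≫ ((β_ X₁ Y₁).hom ⊗ₘ (β_ X₂ Y₂).hom) =
      (β_ (X₁ ⊗ X₂) (Y₁ ⊗ Y₂)).hom ≫ tensorμ Y₁ Y₂ X₁ X₂ := by
  dsimp only [tensorμ]
  simp only [BraidedCategory.braiding_tensor_left_hom, BraidedCategory.braiding_tensor_right_hom]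
  calc
    _ = 𝟙 _ ⊗≫ X₁ ◁ (β_ X₂ Y₁).hom ▷ Y₂ ⊗≫ ((X₁ ⊗ Y₁) ◁ (β_ X₂ Y₂).hom ≫
          (β_ X₁ Y₁).hom ▷ (Y₂ ⊗ X₂)) ⊗≫ Y₁ ◁ 𝟙 (X₁ ⊗ Y₂) ▷ X₂ ⊗≫ 𝟙 _ := by
      rw [tensorHom_def']; monoidal
    _ = _ := by
      -- The identity of `X₁ ⊗ Y₂` displayed in the previous expression is the place where the
      -- double braiding is inserted.
      rw [whisker_exchange, ← SymmetricCategory.symmetry X₁ Y₂]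
      monoidal

/-- The pointwise tensor product of two functors. -/
abbrev tensorFunctor (F G : B ⥤ E) : B ⥤ E := Functor.prod' F G ⋙ tensor E

@[simp]
theorem tensorFunctor_μ (F G : B ⥤ E) [F.Monoidal] [G.Monoidal] (X Y : B) :
    μ (tensorFunctor F G) X Y =
      tensorμ (F.obj X) (G.obj X) (F.obj Y) (G.obj Y) ≫ (μ F X Y ⊗ₘ μ G X Y) := by
  simp [Functor.LaxMonoidal.comp_μ]

theorem tensorFunctor_ε (F G : B ⥤ E) [F.Monoidal] [G.Monoidal] :
    ε (tensorFunctor F G) = (λ_ (𝟙_ E)).inv ≫ (ε F ⊗ₘ ε G) := by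
  simp [Functor.LaxMonoidal.comp_ε]

instance tensorFunctorBraided [SymmetricCategory B] (F G : B ⥤ E) [F.Braided] [G.Braided] :
    (tensorFunctor F G).Braided where
  braided X Y := by
    have h : (tensorμ _ _ _ _ ≫ (μ F X Y ⊗ₘ μ G X Y)) ≫ (F.map (β_ X Y).hom ⊗ₘ G.map (β_ X Y).hom) =
        (β_ (F.obj X ⊗ G.obj X) (F.obj Y ⊗ G.obj Y)).hom ≫ tensorμ _ _ _ _ ≫
          (μ F Y X ⊗ₘ μ G Y X) := by
      rw [Category.assoc, tensorHom_comp_tensorHom, Functor.LaxBraided.braided,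
        Functor.LaxBraided.braided, ← tensorHom_comp_tensorHom,
        reassoc_of% tensorμ_braiding_tensor_braiding]
    rw [tensorFunctor_μ, tensorFunctor_μ]
    exact h

end TensorFunctor

/-! ## Composable pairs of morphisms -/

section Triangle

variable (F : Type u') [Category.{v'} F]

/-- A commutative triangle `comp = snd ∘ fst`. -/
structure Triangle : Type (max u' v') where
  /-- The source. -/
  {src : F}
  /-- The middle object. -/
  {mid : F}
  /-- The target. -/
  {tgt : F}
  /-- The first morphism. -/
  fst : src ⟶ mid
  /-- The second morphism. -/
  snd : mid ⟶ tgt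
  /-- The composition. -/
  comp : src ⟶ tgt
  w : fst ≫ snd = comp

namespace Triangle

variable {F}

/-- An isomorphism of triangles. -/
@[ext]
structure Hom (T T' : Triangle F) : Type v' where
  /-- The square between the first morphisms. -/
  fst : (⟨T.fst⟩ : IsoArrow F) ⟶ ⟨T'.fst⟩
  /-- The square between the second morphisms. -/
  snd : (⟨T.snd⟩ : IsoArrow F) ⟶ ⟨T'.snd⟩
  /-- The square between the compositions. -/
  comp : (⟨T.comp⟩ : IsoArrow F) ⟶ ⟨T'.comp⟩
  fst_right : fst.right = snd.left
  comp_left : comp.left = fst.left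
  comp_right : comp.right = snd.right

instance : Category (Triangle F) where
  Hom T T' := Hom T T'
  id _ := ⟨𝟙 _, 𝟙 _, 𝟙 _, rfl, rfl, rfl⟩
  comp a b := ⟨a.fst ≫ b.fst, a.snd ≫ b.snd, a.comp ≫ b.comp,
    congrArg₂ (· ≪≫ ·) a.fst_right b.fst_right, congrArg₂ (· ≪≫ ·) a.comp_left b.comp_left,
    congrArg₂ (· ≪≫ ·) a.comp_right b.comp_right⟩
  id_comp _ := Hom.ext (Category.id_comp _) (Category.id_comp _) (Category.id_comp _)
  comp_id _ := Hom.ext (Category.comp_id _) (Category.comp_id _) (Category.comp_id _)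
  assoc _ _ _ := Hom.ext (Category.assoc _ _ _) (Category.assoc _ _ _) (Category.assoc _ _ _)

theorem hom_ext {T T' : Triangle F} {a b : T ⟶ T'} (h₁ : a.fst = b.fst) (h₂ : a.snd = b.snd)
    (h₃ : a.comp = b.comp) : a = b :=
  Hom.ext h₁ h₂ h₃

/-- Three compatible isomorphisms form an isomorphism of triangles. -/
def isoMk {T T' : Triangle F} (x : T.src ≅ T'.src) (y : T.mid ≅ T'.mid) (z : T.tgt ≅ T'.tgt)
    (h₁ : T.fst ≫ y.hom = x.hom ≫ T'.fst) (h₂ : T.snd ≫ z.hom = y.hom ≫ T'.snd) : T ≅ T' where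
  hom := ⟨⟨x, y, h₁⟩, ⟨y, z, h₂⟩, ⟨x, z, by
    dsimp only
    rw [← T.w, ← T'.w, Category.assoc, h₂, reassoc_of% h₁]⟩, rfl, rfl, rfl⟩
  inv := ⟨(IsoArrow.isoMk (φ := ⟨_⟩) (φ' := ⟨_⟩) x y h₁).inv,
    (IsoArrow.isoMk (φ := ⟨_⟩) (φ' := ⟨_⟩) y z h₂).inv,
    (IsoArrow.isoMk (φ := ⟨_⟩) (φ' := ⟨_⟩) x z (by
    dsimp only
    rw [← T.w, ← T'.w, Category.assoc, h₂, reassoc_of% h₁])).inv, rfl, rfl, rfl⟩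
  hom_inv_id := hom_ext (IsoArrow.isoMk (φ := ⟨_⟩) (φ' := ⟨_⟩) x y h₁).hom_inv_id
    (IsoArrow.isoMk (φ := ⟨_⟩) (φ' := ⟨_⟩) y z h₂).hom_inv_id
    (IsoArrow.isoMk (φ := ⟨_⟩) (φ' := ⟨_⟩) x z _).hom_inv_id
  inv_hom_id := hom_ext (IsoArrow.isoMk (φ := ⟨_⟩) (φ' := ⟨_⟩) x y h₁).inv_hom_id
    (IsoArrow.isoMk (φ := ⟨_⟩) (φ' := ⟨_⟩) y z h₂).inv_hom_id
    (IsoArrow.isoMk (φ := ⟨_⟩) (φ' := ⟨_⟩) x z _).inv_hom_id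

variable [MonoidalCategory F]

instance : MonoidalCategoryStruct (Triangle F) where
  tensorObj T T' := ⟨T.fst ⊗ₘ T'.fst, T.snd ⊗ₘ T'.snd, T.comp ⊗ₘ T'.comp, by
    rw [tensorHom_comp_tensorHom, T.w, T'.w]⟩
  tensorHom a b := ⟨a.fst ⊗ₘ b.fst, a.snd ⊗ₘ b.snd, a.comp ⊗ₘ b.comp,
    congrArg₂ (· ⊗ᵢ ·) a.fst_right b.fst_right, congrArg₂ (· ⊗ᵢ ·) a.comp_left b.comp_left,
    congrArg₂ (· ⊗ᵢ ·) a.comp_right b.comp_right⟩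
  whiskerLeft T _ _ b := ⟨(⟨T.fst⟩ : IsoArrow F) ◁ b.fst, (⟨T.snd⟩ : IsoArrow F) ◁ b.snd,
    (⟨T.comp⟩ : IsoArrow F) ◁ b.comp,
    congrArg (whiskerLeftIso _) b.fst_right, congrArg (whiskerLeftIso _) b.comp_left,
    congrArg (whiskerLeftIso _) b.comp_right⟩
  whiskerRight a T := ⟨a.fst ▷ (⟨T.fst⟩ : IsoArrow F), a.snd ▷ (⟨T.snd⟩ : IsoArrow F),
    a.comp ▷ (⟨T.comp⟩ : IsoArrow F),
    congrArg (whiskerRightIso · _) a.fst_right, congrArg (whiskerRightIso · _) a.comp_left,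
    congrArg (whiskerRightIso · _) a.comp_right⟩
  tensorUnit := ⟨𝟙 (𝟙_ F), 𝟙 (𝟙_ F), 𝟙 (𝟙_ F), Category.comp_id _⟩
  associator _ _ _ := isoMk (α_ _ _ _) (α_ _ _ _) (α_ _ _ _) (by simp) (by simp)
  leftUnitor _ := isoMk (λ_ _) (λ_ _) (λ_ _) (by simp) (by simp)
  rightUnitor _ := isoMk (ρ_ _) (ρ_ _) (ρ_ _) (by simp) (by simp)

instance : MonoidalCategory (Triangle F) where
  tensorHom_def _ _ := hom_ext (tensorHom_def _ _) (tensorHom_def _ _) (tensorHom_def _ _)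
  id_tensorHom_id _ _ := hom_ext (id_tensorHom_id _ _) (id_tensorHom_id _ _) (id_tensorHom_id _ _)
  tensorHom_comp_tensorHom _ _ _ _ :=
    hom_ext (tensorHom_comp_tensorHom _ _ _ _) (tensorHom_comp_tensorHom _ _ _ _)
      (tensorHom_comp_tensorHom _ _ _ _)
  whiskerLeft_id _ _ := hom_ext (whiskerLeft_id _ _) (whiskerLeft_id _ _) (whiskerLeft_id _ _)
  id_whiskerRight _ _ := hom_ext (id_whiskerRight _ _) (id_whiskerRight _ _) (id_whiskerRight _ _)
  associator_naturality _ _ _ := hom_ext (associator_naturality _ _ _)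
    (associator_naturality _ _ _) (associator_naturality _ _ _)
  leftUnitor_naturality _ := hom_ext (leftUnitor_naturality _) (leftUnitor_naturality _)
    (leftUnitor_naturality _)
  rightUnitor_naturality _ := hom_ext (rightUnitor_naturality _) (rightUnitor_naturality _)
    (rightUnitor_naturality _)
  pentagon T₁ T₂ T₃ T₄ := hom_ext
    (pentagon (C := IsoArrow F) ⟨T₁.fst⟩ ⟨T₂.fst⟩ ⟨T₃.fst⟩ ⟨T₄.fst⟩)
    (pentagon (C := IsoArrow F) ⟨T₁.snd⟩ ⟨T₂.snd⟩ ⟨T₃.snd⟩ ⟨T₄.snd⟩)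
    (pentagon (C := IsoArrow F) ⟨T₁.comp⟩ ⟨T₂.comp⟩ ⟨T₃.comp⟩ ⟨T₄.comp⟩)
  triangle T T' := hom_ext (triangle (C := IsoArrow F) ⟨T.fst⟩ ⟨T'.fst⟩)
    (triangle (C := IsoArrow F) ⟨T.snd⟩ ⟨T'.snd⟩) (triangle (C := IsoArrow F) ⟨T.comp⟩ ⟨T'.comp⟩)

instance [SymmetricCategory F] : BraidedCategory (Triangle F) where
  braiding T T' := isoMk (β_ T.src T'.src) (β_ T.mid T'.mid) (β_ T.tgt T'.tgt)
    (BraidedCategory.braiding_naturality T.fst T'.fst)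
    (BraidedCategory.braiding_naturality T.snd T'.snd)
  braiding_naturality_right T _ _ b := hom_ext
    (BraidedCategory.braiding_naturality_right (⟨T.fst⟩ : IsoArrow F) b.fst)
    (BraidedCategory.braiding_naturality_right (⟨T.snd⟩ : IsoArrow F) b.snd)
    (BraidedCategory.braiding_naturality_right (⟨T.comp⟩ : IsoArrow F) b.comp)
  braiding_naturality_left a T := hom_ext
    (BraidedCategory.braiding_naturality_left a.fst (⟨T.fst⟩ : IsoArrow F))
    (BraidedCategory.braiding_naturality_left a.snd (⟨T.snd⟩ : IsoArrow F))
    (BraidedCategory.braiding_naturality_left a.comp (⟨T.comp⟩ : IsoArrow F))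
  hexagon_forward T T' T'' := hom_ext
    (BraidedCategory.hexagon_forward (C := IsoArrow F) ⟨T.fst⟩ ⟨T'.fst⟩ ⟨T''.fst⟩)
    (BraidedCategory.hexagon_forward (C := IsoArrow F) ⟨T.snd⟩ ⟨T'.snd⟩ ⟨T''.snd⟩)
    (BraidedCategory.hexagon_forward (C := IsoArrow F) ⟨T.comp⟩ ⟨T'.comp⟩ ⟨T''.comp⟩)
  hexagon_reverse T T' T'' := hom_ext
    (BraidedCategory.hexagon_reverse (C := IsoArrow F) ⟨T.fst⟩ ⟨T'.fst⟩ ⟨T''.fst⟩)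
    (BraidedCategory.hexagon_reverse (C := IsoArrow F) ⟨T.snd⟩ ⟨T'.snd⟩ ⟨T''.snd⟩)
    (BraidedCategory.hexagon_reverse (C := IsoArrow F) ⟨T.comp⟩ ⟨T'.comp⟩ ⟨T''.comp⟩)

instance [SymmetricCategory F] : SymmetricCategory (Triangle F) where
  symmetry T T' := hom_ext
    (SymmetricCategory.symmetry (C := IsoArrow F) ⟨T.fst⟩ ⟨T'.fst⟩)
    (SymmetricCategory.symmetry (C := IsoArrow F) ⟨T.snd⟩ ⟨T'.snd⟩)
    (SymmetricCategory.symmetry (C := IsoArrow F) ⟨T.comp⟩ ⟨T'.comp⟩)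

variable (F) in
/-- The first morphism of a triangle. -/
def fstFunctor : Triangle F ⥤ IsoArrow F where
  obj T := ⟨T.fst⟩
  map a := a.fst

variable (F) in
/-- The second morphism of a triangle. -/
def sndFunctor : Triangle F ⥤ IsoArrow F where
  obj T := ⟨T.snd⟩
  map a := a.snd

variable (F) in
/-- The composition of a triangle. -/
def compFunctor : Triangle F ⥤ IsoArrow F where
  obj T := ⟨T.comp⟩
  map a := a.comp

end Triangle

end Triangle

/-! ### The projections from triangles to arrows as braided functors. -/

section

/-- This and the next two lemmas are the coherence conditions of a monoidal functor whose structure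
maps are identities. The projections below satisfy them after definitional unfolding. -/
theorem id_whiskerRight_id_associator {E : Type u} [Category.{v} E] [MonoidalCategory E]
    (X Y Z : E) : 𝟙 (X ⊗ Y) ▷ Z ≫ 𝟙 ((X ⊗ Y) ⊗ Z) ≫ (α_ X Y Z).hom =
      (α_ X Y Z).hom ≫ X ◁ 𝟙 (Y ⊗ Z) ≫ 𝟙 (X ⊗ Y ⊗ Z) := by simp

theorem leftUnitor_eq_id_whiskerRight {E : Type u} [Category.{v} E] [MonoidalCategory E] (X : E) :
    (λ_ X).hom = 𝟙 (𝟙_ E) ▷ X ≫ 𝟙 (𝟙_ E ⊗ X) ≫ (λ_ X).hom := by simp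

theorem rightUnitor_eq_whiskerLeft_id {E : Type u} [Category.{v} E] [MonoidalCategory E] (X : E) :
    (ρ_ X).hom = X ◁ 𝟙 (𝟙_ E) ≫ 𝟙 (X ⊗ 𝟙_ E) ≫ (ρ_ X).hom := by simp

variable (F : Type u') [Category.{v'} F] [MonoidalCategory F] [SymmetricCategory F]

instance : (Triangle.fstFunctor F).Braided where
  toMonoidal := Functor.CoreMonoidal.toMonoidal
    { εIso := Iso.refl (𝟙_ (IsoArrow F))
      μIso T T' := Iso.refl (⟨(T ⊗ T').fst⟩ : IsoArrow F)
      μIso_hom_natural_left _ _ := (Category.comp_id _).trans (Category.id_comp _).symm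
      μIso_hom_natural_right _ _ := (Category.comp_id _).trans (Category.id_comp _).symm
      associativity T₁ T₂ T₃ :=
        id_whiskerRight_id_associator (E := IsoArrow F) ⟨T₁.fst⟩ ⟨T₂.fst⟩ ⟨T₃.fst⟩
      left_unitality _ := leftUnitor_eq_id_whiskerRight (E := IsoArrow F) _
      right_unitality _ := rightUnitor_eq_whiskerLeft_id (E := IsoArrow F) _ }
  braided _ _ := (Category.id_comp _).trans (Category.comp_id _).symm

instance : (Triangle.sndFunctor F).Braided where
  toMonoidal := Functor.CoreMonoidal.toMonoidal
    { εIso := Iso.refl (𝟙_ (IsoArrow F))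
      μIso T T' := Iso.refl (⟨(T ⊗ T').snd⟩ : IsoArrow F)
      μIso_hom_natural_left _ _ := (Category.comp_id _).trans (Category.id_comp _).symm
      μIso_hom_natural_right _ _ := (Category.comp_id _).trans (Category.id_comp _).symm
      associativity T₁ T₂ T₃ :=
        id_whiskerRight_id_associator (E := IsoArrow F) ⟨T₁.snd⟩ ⟨T₂.snd⟩ ⟨T₃.snd⟩
      left_unitality _ := leftUnitor_eq_id_whiskerRight (E := IsoArrow F) _
      right_unitality _ := rightUnitor_eq_whiskerLeft_id (E := IsoArrow F) _ }
  braided _ _ := (Category.id_comp _).trans (Category.comp_id _).symm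

instance : (Triangle.compFunctor F).Braided where
  toMonoidal := Functor.CoreMonoidal.toMonoidal
    { εIso := Iso.refl (𝟙_ (IsoArrow F))
      μIso T T' := Iso.refl (⟨(T ⊗ T').comp⟩ : IsoArrow F)
      μIso_hom_natural_left _ _ := (Category.comp_id _).trans (Category.id_comp _).symm
      μIso_hom_natural_right _ _ := (Category.comp_id _).trans (Category.id_comp _).symm
      associativity T₁ T₂ T₃ :=
        id_whiskerRight_id_associator (E := IsoArrow F) ⟨T₁.comp⟩ ⟨T₂.comp⟩ ⟨T₃.comp⟩
      left_unitality _ := leftUnitor_eq_id_whiskerRight (E := IsoArrow F) _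
      right_unitality _ := rightUnitor_eq_whiskerLeft_id (E := IsoArrow F) _ }
  braided _ _ := (Category.id_comp _).trans (Category.comp_id _).symm

end

/-! ## Generators of the groupoids of morphisms and of composable pairs of `FI` -/

namespace FI

/-- The bijection which underlies an isomorphism of `FI`. -/
def equivOfIso {X Y : FI.{w}} (e : X ≅ Y) : X.carrier ≃ Y.carrier where
  toFun := e.hom.emb
  invFun := e.inv.emb
  left_inv x := by rw [← comp_emb, e.hom_inv_id, id_emb]
  right_inv x := by rw [← comp_emb, e.inv_hom_id, id_emb]

theorem square_apply {X Y X' Y' : FI.{w}} {f : X ⟶ Y} {f' : X' ⟶ Y'} {e : Y ⟶ Y'} {e' : X ⟶ X'}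
    (h : f ≫ e = e' ≫ f') (x : X.carrier) : e.emb (f.emb x) = f'.emb (e'.emb x) :=
  congrArg (fun g : X ⟶ Y' => g.emb x) h

theorem cancel_emb {X Y Z : FI.{w}} {f g : X ⟶ Y} {i : Y ⟶ Z} (h : f ≫ i = g ≫ i) : f = g :=
  hom_ext fun x => i.emb.injective (congrArg (fun g : X ⟶ Z => g.emb x) h)

/-- The image of an isomorphic morphism. -/
theorem mem_range_iff {X Y X' Y' : FI.{w}} {f : X ⟶ Y} {f' : X' ⟶ Y'} {e : Y ≅ Y'} {e' : X ≅ X'}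
    (h : f ≫ e.hom = e'.hom ≫ f') (y : Y.carrier) :
    (∃ x, f'.emb x = e.hom.emb y) ↔ ∃ x, f.emb x = y := by
  constructor
  · rintro ⟨x, hx⟩
    obtain ⟨x, rfl⟩ := (equivOfIso e').surjective x
    exact ⟨x, (equivOfIso e).injective ((square_apply h x).trans hx)⟩
  · rintro ⟨x, rfl⟩
    exact ⟨e'.hom.emb x, (square_apply h x).symm⟩

/-- A bijection between the targets which respects the images lifts to the sources. -/
theorem exists_iso_of_range {X Y X' Y' : FI.{w}} (f : X ⟶ Y) (f' : X' ⟶ Y') (e : Y ≅ Y')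
    (h : ∀ y, (∃ x, f'.emb x = e.hom.emb y) ↔ ∃ x, f.emb x = y) :
    ∃ e' : X ≅ X', f ≫ e.hom = e'.hom ≫ f' := by
  choose g hg using fun x => (h (f.emb x)).2 ⟨x, rfl⟩
  have hg' : Function.Bijective g := by
    refine ⟨fun x x' hx => ?_, fun x' => ?_⟩
    · have := (hg x).symm.trans ((congrArg f'.emb hx).trans (hg x'))
      exact f.emb.injective ((equivOfIso e).injective this)
    · obtain ⟨y, hy⟩ := (equivOfIso e).surjective (f'.emb x')
      obtain ⟨x, rfl⟩ := (h y).1 ⟨x', hy.symm⟩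
      exact ⟨x, f'.emb.injective ((hg x).trans hy)⟩
  exact ⟨isoOfEquiv (Equiv.ofBijective g hg'), hom_ext fun x => (hg x).symm⟩

theorem exists_tensorHom_inl {X Y X' Y' : FI.{w}} (f : X ⟶ Y) (f' : X' ⟶ Y') (y : Y.carrier) :
    (∃ x, (f ⊗ₘ f').emb x = Sum.inl y) ↔ ∃ x, f.emb x = y := by
  constructor
  · rintro ⟨x | x, hx⟩
    · exact ⟨x, Sum.inl_injective hx⟩
    · exact (Sum.inr_ne_inl hx).elim
  · rintro ⟨x, rfl⟩
    exact ⟨Sum.inl x, rfl⟩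

theorem exists_tensorHom_inr {X Y X' Y' : FI.{w}} (f : X ⟶ Y) (f' : X' ⟶ Y') (y : Y'.carrier) :
    (∃ x, (f ⊗ₘ f').emb x = Sum.inr y) ↔ ∃ x, f'.emb x = y := by
  constructor
  · rintro ⟨x | x, hx⟩
    · exact (Sum.inl_ne_inr hx).elim
    · exact ⟨x, Sum.inr_injective hx⟩
  · rintro ⟨x, rfl⟩
    exact ⟨Sum.inr x, rfl⟩

end FI

namespace IsoArrow

open Classical in
/-- The target of a morphism, coloured by whether an element is in the image. -/
noncomputable def toColoredSet : IsoArrow FI.{w} ⥤ ColoredSet.{w} Bool where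
  obj φ := ⟨φ.tgt.carrier, fun y => decide (∃ x, φ.arr.emb x = y)⟩
  map a := ⟨FI.equivOfIso a.right, fun y => decide_eq_decide.2 (FI.mem_range_iff a.w y)⟩

open Classical in
noncomputable instance : toColoredSet.{w}.Braided where
  toMonoidal := Functor.CoreMonoidal.toMonoidal
    { εIso := ColoredSet.isoMk (Equiv.refl _) fun x => x.elim
      μIso φ ψ := ColoredSet.isoMk (Equiv.refl _) (by
        rintro (y | y)
        · exact decide_eq_decide.2 (FI.exists_tensorHom_inl φ.arr ψ.arr y)
        · exact decide_eq_decide.2 (FI.exists_tensorHom_inr φ.arr ψ.arr y))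
      μIso_hom_natural_left _ _ := ColoredSet.hom_ext (by rintro (_ | _) <;> rfl)
      μIso_hom_natural_right _ _ := ColoredSet.hom_ext (by rintro (_ | _) <;> rfl)
      associativity _ _ _ := ColoredSet.hom_ext (by rintro ((_ | _) | _) <;> rfl)
      left_unitality _ := ColoredSet.hom_ext (by rintro (x | _); exacts [x.elim, rfl])
      right_unitality _ := ColoredSet.hom_ext (by rintro (_ | x); exacts [rfl, x.elim]) }
  braided _ _ := ColoredSet.hom_ext (by rintro (_ | _) <;> rfl)

/-- The bijection of the sources is determined by that of the targets because `ψ.arr` is a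
monomorphism. -/
instance : toColoredSet.{w}.Faithful where
  map_injective {φ ψ a b} h := by
    have hr : a.right.hom = b.right.hom := FI.hom_ext fun y => congrArg (fun f => f.equiv y) h
    exact hom_ext (FI.cancel_emb (by rw [← a.w, ← b.w, hr])) hr

/-- A bijection preserving the colours preserves the images, so it lifts to the sources. -/
instance : toColoredSet.{w}.Full where
  map_surjective {φ ψ} f := by
    obtain ⟨e, he⟩ := FI.exists_iso_of_range φ.arr ψ.arr (FI.isoOfEquiv f.equiv) fun y =>
      decide_eq_decide.1 (f.color_equiv y)
    exact ⟨⟨e, FI.isoOfEquiv f.equiv, he⟩, rfl⟩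

/-- The identity of the point and the injection of the empty set into the point. -/
def generator : Bool → IsoArrow FI.{w}
  | true => ⟨𝟙 FI.pt⟩
  | false => ⟨FI.fromEmpty⟩

open Classical in
theorem freelyGenerates_generator : FreelyGenerates generator.{w} :=
  ColoredSet.freelyGenerates_point.{w}.of_fullyFaithful toColoredSet fun
    | true => ColoredSet.isoMk (Equiv.refl PUnit) fun y => by
      exact (decide_eq_true ⟨y, rfl⟩).symm
    | false => ColoredSet.isoMk (Equiv.refl PUnit) fun y => by
      exact (decide_eq_false (by rintro ⟨x, -⟩; exact x.elim)).symm

end IsoArrow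

/-! ### Composable pairs as finite sets with three colours. -/

namespace Triangle

open Classical in
/-- The position of an element in the filtration of the target of a triangle by the images. -/
noncomputable def color (T : Triangle FI.{w}) (z : T.tgt.carrier) : Fin 3 :=
  if ∃ x, T.comp.emb x = z then 0 else if ∃ y, T.snd.emb y = z then 1 else 2

open Classical in
theorem color_congr {T T' : Triangle FI.{w}} {z : T.tgt.carrier} {z' : T'.tgt.carrier}
    (h₁ : (∃ x, T.comp.emb x = z) ↔ ∃ x, T'.comp.emb x = z')
    (h₂ : (∃ x, T.snd.emb x = z) ↔ ∃ x, T'.snd.emb x = z') : T.color z = T'.color z' :=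
  if_congr h₁ rfl (if_congr h₂ rfl rfl)

theorem exists_snd_of_exists_comp {T : Triangle FI.{w}} {z : T.tgt.carrier}
    (h : ∃ x, T.comp.emb x = z) : ∃ y, T.snd.emb y = z := by
  obtain ⟨x, rfl⟩ := h
  exact ⟨T.fst.emb x, by rw [← T.w]; rfl⟩

/-- The image of the composition lies in that of the second morphism, so three colours suffice to
record both memberships. -/
theorem color_eq_iff {T T' : Triangle FI.{w}} {z : T.tgt.carrier} {z' : T'.tgt.carrier} :
    T.color z = T'.color z' ↔ ((∃ x, T.comp.emb x = z) ↔ ∃ x, T'.comp.emb x = z') ∧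
      ((∃ x, T.snd.emb x = z) ↔ ∃ x, T'.snd.emb x = z') := by
  refine ⟨fun h => ?_, fun h => color_congr h.1 h.2⟩
  have h₁ := exists_snd_of_exists_comp (T := T) (z := z)
  have h₂ := exists_snd_of_exists_comp (T := T') (z := z')
  unfold color at h
  split_ifs at h <;> tauto

theorem snd_square {T T' : Triangle FI.{w}} (a : T ⟶ T') :
    T.snd ≫ a.comp.right.hom = a.snd.left.hom ≫ T'.snd := by
  rw [a.comp_right]
  exact a.snd.w

/-- The target of a triangle, coloured by the filtration. -/
noncomputable def toColoredSet : Triangle FI.{w} ⥤ ColoredSet.{w} (Fin 3) where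
  obj T := ⟨T.tgt.carrier, T.color⟩
  map a := ⟨FI.equivOfIso a.comp.right, fun z =>
    color_congr (FI.mem_range_iff a.comp.w z) (FI.mem_range_iff (snd_square a) z)⟩

noncomputable instance : toColoredSet.{w}.Braided where
  toMonoidal := Functor.CoreMonoidal.toMonoidal
    { εIso := ColoredSet.isoMk (Equiv.refl _) fun x => x.elim
      μIso T T' := ColoredSet.isoMk (Equiv.refl _) (by
        rintro (y | y)
        · exact color_congr (FI.exists_tensorHom_inl T.comp T'.comp y)
            (FI.exists_tensorHom_inl T.snd T'.snd y)
        · exact color_congr (FI.exists_tensorHom_inr T.comp T'.comp y)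
            (FI.exists_tensorHom_inr T.snd T'.snd y))
      μIso_hom_natural_left _ _ := ColoredSet.hom_ext (by rintro (_ | _) <;> rfl)
      μIso_hom_natural_right _ _ := ColoredSet.hom_ext (by rintro (_ | _) <;> rfl)
      associativity _ _ _ := ColoredSet.hom_ext (by rintro ((_ | _) | _) <;> rfl)
      left_unitality _ := ColoredSet.hom_ext (by rintro (x | _); exacts [x.elim, rfl])
      right_unitality _ := ColoredSet.hom_ext (by rintro (_ | x); exacts [rfl, x.elim]) }
  braided _ _ := ColoredSet.hom_ext (by rintro (_ | _) <;> rfl)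

instance : toColoredSet.{w}.Faithful where
  map_injective {T T' a b} h := by
    have h₁ : a.comp.right.hom = b.comp.right.hom :=
      FI.hom_ext fun y => congrArg (fun f => f.equiv y) h
    have h₂ : a.snd.right.hom = b.snd.right.hom := by rw [← a.comp_right, ← b.comp_right, h₁]
    have h₃ : a.snd.left.hom = b.snd.left.hom := FI.cancel_emb (by
      rw [← snd_square, ← snd_square, h₁])
    have h₄ : a.comp.left.hom = b.comp.left.hom := FI.cancel_emb (i := T'.comp) (by
      rw [← a.comp.w, ← b.comp.w, h₁])
    exact hom_ext (IsoArrow.hom_ext (by rw [← a.comp_left, ← b.comp_left, h₄])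
      (by rw [a.fst_right, b.fst_right, h₃])) (IsoArrow.hom_ext h₃ h₂) (IsoArrow.hom_ext h₄ h₁)

instance : toColoredSet.{w}.Full where
  map_surjective {T T'} f := by
    obtain ⟨y, hy⟩ := FI.exists_iso_of_range T.snd T'.snd (FI.isoOfEquiv f.equiv) fun z =>
      (color_eq_iff.1 (f.color_equiv z)).2
    obtain ⟨x, hx⟩ := FI.exists_iso_of_range T.comp T'.comp (FI.isoOfEquiv f.equiv) fun z =>
      (color_eq_iff.1 (f.color_equiv z)).1
    -- The bijections `x` and `y` were lifted independently; their compatibility can be tested after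
    -- composing with the monomorphism `T'.snd`.
    refine ⟨(isoMk x y (FI.isoOfEquiv f.equiv) (FI.cancel_emb (i := T'.snd) ?_) hy).hom, rfl⟩
    rw [Category.assoc, ← hy, ← Category.assoc, T.w, hx, Category.assoc, T'.w]

/-- The composable pairs of the identity of the point and the injections of the empty set. -/
def generator : Fin 3 → Triangle FI.{w}
  | 0 => ⟨𝟙 FI.pt, 𝟙 FI.pt, 𝟙 FI.pt, Category.comp_id _⟩
  | 1 => ⟨FI.fromEmpty, 𝟙 FI.pt, FI.fromEmpty, Category.comp_id _⟩
  | 2 => ⟨𝟙 (𝟙_ FI), FI.fromEmpty, FI.fromEmpty, Category.id_comp _⟩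

theorem freelyGenerates_generator : FreelyGenerates generator.{w} :=
  ColoredSet.freelyGenerates_point.{w}.of_fullyFaithful toColoredSet fun
    | 0 => ColoredSet.isoMk (Equiv.refl PUnit) fun y => by
      exact (if_pos ⟨y, rfl⟩).symm
    | 1 => ColoredSet.isoMk (Equiv.refl PUnit) fun y => by
      exact ((if_neg (by rintro ⟨x, -⟩; exact x.elim)).trans (if_pos ⟨y, rfl⟩)).symm
    | 2 => ColoredSet.isoMk (Equiv.refl PUnit) fun y => by
      exact ((if_neg (by rintro ⟨x, -⟩; exact x.elim)).trans
        (if_neg (by rintro ⟨x, -⟩; exact x.elim))).symm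

end Triangle

/-! ### Identity morphisms as finite sets with one colour. -/

namespace FI

/-- The functor which sends a finite set to its identity morphism. -/
def idArrow : ColoredSet.{w} Unit ⥤ IsoArrow FI.{w} where
  obj X := ⟨𝟙 ⟨X.carrier⟩⟩
  map f := IsoArrow.idSquare (isoOfEquiv f.equiv)

instance : idArrow.{w}.Braided where
  toMonoidal := Functor.CoreMonoidal.toMonoidal
    { εIso := Iso.refl _
      μIso X Y := IsoArrow.isoMk (Iso.refl _) (Iso.refl _) (hom_ext (by rintro (_ | _) <;> rfl))
      μIso_hom_natural_left _ _ := IsoArrow.hom_ext (hom_ext (by rintro (_ | _) <;> rfl))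
        (hom_ext (by rintro (_ | _) <;> rfl))
      μIso_hom_natural_right _ _ := IsoArrow.hom_ext (hom_ext (by rintro (_ | _) <;> rfl))
        (hom_ext (by rintro (_ | _) <;> rfl))
      associativity _ _ _ := IsoArrow.hom_ext (hom_ext (by rintro ((_ | _) | _) <;> rfl))
        (hom_ext (by rintro ((_ | _) | _) <;> rfl))
      left_unitality _ := IsoArrow.hom_ext (hom_ext (by rintro (x | _); exacts [x.elim, rfl]))
        (hom_ext (by rintro (x | _); exacts [x.elim, rfl]))
      right_unitality _ := IsoArrow.hom_ext (hom_ext (by rintro (_ | x); exacts [rfl, x.elim]))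
        (hom_ext (by rintro (_ | x); exacts [rfl, x.elim])) }
  braided _ _ := IsoArrow.hom_ext (hom_ext (by rintro (_ | _) <;> rfl))
    (hom_ext (by rintro (_ | _) <;> rfl))

end FI

/-! ## Induction on chains of injections -/

namespace FI

/-- A decomposition of the target induces one of the source; the parts are realised as the subsets
of `Y₁` and `Y₂` hit by `f`. -/
theorem exists_split {X Y Y₁ Y₂ : FI.{w}} (f : X ⟶ Y) (e : Y ≅ Y₁ ⊗ Y₂) :
    ∃ (X₁ X₂ : FI.{w}) (d : X ≅ X₁ ⊗ X₂) (f₁ : X₁ ⟶ Y₁) (f₂ : X₂ ⟶ Y₂),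
      f ≫ e.hom = d.hom ≫ (f₁ ⊗ₘ f₂) := by
  let f₁ : (⟨{y // ∃ x, e.hom.emb (f.emb x) = Sum.inl y}⟩ : FI) ⟶ Y₁ := ⟨Function.Embedding.subtype _⟩
  let f₂ : (⟨{y // ∃ x, e.hom.emb (f.emb x) = Sum.inr y}⟩ : FI) ⟶ Y₂ := ⟨Function.Embedding.subtype _⟩
  obtain ⟨d, hd⟩ := exists_iso_of_range f (f₁ ⊗ₘ f₂) e fun y => by
    have h (x) : e.hom.emb (f.emb x) = e.hom.emb y ↔ f.emb x = y :=
      (equivOfIso e).injective.eq_iff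
    rcases h' : e.hom.emb y with z | z
    · rw [exists_tensorHom_inl]
      simp only [← h, h']
      exact ⟨fun ⟨⟨z', x, hx⟩, hz⟩ => ⟨x, hx.trans (congrArg _ hz)⟩, fun ⟨x, hx⟩ => ⟨⟨z, x, hx⟩, rfl⟩⟩
    · rw [exists_tensorHom_inr]
      simp only [← h, h']
      exact ⟨fun ⟨⟨z', x, hx⟩, hz⟩ => ⟨x, hx.trans (congrArg _ hz)⟩, fun ⟨x, hx⟩ => ⟨⟨z, x, hx⟩, rfl⟩⟩
  exact ⟨_, _, d, f₁, f₂, hd⟩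

theorem exists_iso_tensorUnit {X Y : FI.{w}} (f : X ⟶ Y) (e : Y ≅ 𝟙_ FI) :
    ∃ d : X ≅ 𝟙_ FI, f ≫ e.hom = d.hom ≫ 𝟙 (𝟙_ FI) :=
  exists_iso_of_range f (𝟙 (𝟙_ FI)) e fun y => PEmpty.elim (e.hom.emb y)

theorem exists_iso_pt_or {X Y : FI.{w}} (f : X ⟶ Y) (e : Y ≅ pt) :
    (∃ d : X ≅ pt, f ≫ e.hom = d.hom ≫ 𝟙 pt) ∨
      ∃ d : X ≅ 𝟙_ FI, f ≫ e.hom = d.hom ≫ fromEmpty := by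
  by_cases hX : Nonempty X.carrier
  · refine .inl (exists_iso_of_range f (𝟙 pt) e fun y => ⟨fun _ => ?_, fun _ => ⟨_, rfl⟩⟩)
    exact ⟨hX.some, (equivOfIso e).injective rfl⟩
  · refine .inr (exists_iso_of_range f fromEmpty e fun y => ⟨fun ⟨x, _⟩ => x.elim, fun ⟨x, _⟩ => ?_⟩)
    exact (hX ⟨x⟩).elim

/-- A property of chains of three composable injections which is invariant under isomorphisms and
stable under disjoint unions holds for all chains if it holds for the chains in the point. -/
theorem chain_induction {P : ∀ {W X Y Z : FI.{w}}, (W ⟶ X) → (X ⟶ Y) → (Y ⟶ Z) → Prop}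
    (of_iso : ∀ {W X Y Z W' X' Y' Z' : FI.{w}} {f : W ⟶ X} {g : X ⟶ Y} {h : Y ⟶ Z} {f' : W' ⟶ X'}
      {g' : X' ⟶ Y'} {h' : Y' ⟶ Z'} (a : W ≅ W') (b : X ≅ X') (c : Y ≅ Y') (d : Z ≅ Z'),
      f ≫ b.hom = a.hom ≫ f' → g ≫ c.hom = b.hom ≫ g' → h ≫ d.hom = c.hom ≫ h' →
      P f' g' h' → P f g h)
    (tensor : ∀ {W X Y Z W' X' Y' Z' : FI.{w}} {f : W ⟶ X} {g : X ⟶ Y} {h : Y ⟶ Z} {f' : W' ⟶ X'}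
      {g' : X' ⟶ Y'} {h' : Y' ⟶ Z'}, P f g h → P f' g' h' → P (f ⊗ₘ f') (g ⊗ₘ g') (h ⊗ₘ h'))
    (unit : P (𝟙 (𝟙_ FI)) (𝟙 (𝟙_ FI)) (𝟙 (𝟙_ FI)))
    (pt₀ : P (𝟙 pt) (𝟙 pt) (𝟙 pt)) (pt₁ : P fromEmpty (𝟙 pt) (𝟙 pt))
    (pt₂ : P (𝟙 (𝟙_ FI)) fromEmpty (𝟙 pt)) (pt₃ : P (𝟙 (𝟙_ FI)) (𝟙 (𝟙_ FI)) fromEmpty)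
    {W X Y Z : FI.{w}} (f : W ⟶ X) (g : X ⟶ Y) (h : Y ⟶ Z) : P f g h := by
  obtain ⟨Z⟩ := Z
  refine Finite.induction_empty_option (P := fun Z => ∀ (_ : Finite Z) {W X Y : FI.{w}}
    (f : W ⟶ X) (g : X ⟶ Y) (h : Y ⟶ (⟨Z⟩ : FI.{w})), P f g h) ?_ ?_ ?_ Z ‹_› f g h
  · intro Z Z' e ih _ W X Y f g h
    have : Finite Z := .of_equiv _ e.symm
    let i : (⟨Z'⟩ : FI) ≅ ⟨Z⟩ := isoOfEquiv e.symm
    exact of_iso (Iso.refl _) (Iso.refl _) (Iso.refl _) i (by simp) (by simp)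
      (f' := f) (g' := g) (h' := h ≫ i.hom) (by simp) (ih this f g _)
  · intro _ W X Y f g h
    let i : (⟨PEmpty⟩ : FI) ≅ 𝟙_ FI := isoOfEquiv (Equiv.refl _)
    obtain ⟨c, hc⟩ := exists_iso_tensorUnit h i
    obtain ⟨b, hb⟩ := exists_iso_tensorUnit g c
    obtain ⟨a, ha⟩ := exists_iso_tensorUnit f b
    exact of_iso a b c i ha hb hc unit
  · intro Z _ ih _ W X Y f g h
    let i : (⟨Option Z⟩ : FI) ≅ ⟨Z⟩ ⊗ pt := isoOfEquiv (Equiv.optionEquivSumPUnit Z)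
    -- The splitting of the last set into `Z` and a point is pulled back along the whole chain, one
    -- morphism at a time.
    obtain ⟨Y₁, Y₂, c, h₁, h₂, hc⟩ := exists_split h i
    obtain ⟨X₁, X₂, b, g₁, g₂, hb⟩ := exists_split g c
    obtain ⟨W₁, W₂, a, f₁, f₂, ha⟩ := exists_split f b
    refine of_iso a b c i ha hb hc (tensor (ih inferInstance f₁ g₁ h₁) ?_)
    -- A chain in the point is determined by the stage at which it becomes nonempty, which leaves
    -- four cases.
    obtain ⟨c, hc⟩ | ⟨c, hc⟩ := exists_iso_pt_or h₂ (Iso.refl pt)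
    · obtain ⟨b, hb⟩ | ⟨b, hb⟩ := exists_iso_pt_or g₂ c
      · obtain ⟨a, ha⟩ | ⟨a, ha⟩ := exists_iso_pt_or f₂ b
        · exact of_iso a b c _ ha hb hc pt₀
        · exact of_iso a b c _ ha hb hc pt₁
      · obtain ⟨a, ha⟩ := exists_iso_tensorUnit f₂ b
        exact of_iso a b c _ ha hb hc pt₂
    · obtain ⟨b, hb⟩ := exists_iso_tensorUnit g₂ c
      obtain ⟨a, ha⟩ := exists_iso_tensorUnit f₂ b
      exact of_iso a b c _ ha hb hc pt₃

/-- The induction principle for pairs of composable injections. -/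
theorem pair_induction {P : ∀ {X Y Z : FI.{w}}, (X ⟶ Y) → (Y ⟶ Z) → Prop}
    (of_iso : ∀ {X Y Z X' Y' Z' : FI.{w}} {g : X ⟶ Y} {h : Y ⟶ Z} {g' : X' ⟶ Y'} {h' : Y' ⟶ Z'}
      (b : X ≅ X') (c : Y ≅ Y') (d : Z ≅ Z'),
      g ≫ c.hom = b.hom ≫ g' → h ≫ d.hom = c.hom ≫ h' → P g' h' → P g h)
    (tensor : ∀ {X Y Z X' Y' Z' : FI.{w}} {g : X ⟶ Y} {h : Y ⟶ Z} {g' : X' ⟶ Y'} {h' : Y' ⟶ Z'},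
      P g h → P g' h' → P (g ⊗ₘ g') (h ⊗ₘ h'))
    (unit : P (𝟙 (𝟙_ FI)) (𝟙 (𝟙_ FI))) (pt₀ : P (𝟙 pt) (𝟙 pt)) (pt₁ : P fromEmpty (𝟙 pt))
    (pt₂ : P (𝟙 (𝟙_ FI)) fromEmpty) {X Y Z : FI.{w}} (g : X ⟶ Y) (h : Y ⟶ Z) : P g h :=
  -- The pair is extended by an identity in front that the property ignores, so the first two chains
  -- in the point give the same pair.
  chain_induction (P := fun _ g h => P g h) (fun _ b c d _ hg hh => of_iso b c d hg hh) tensor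
    unit pt₀ pt₀ pt₁ pt₂ (𝟙 X) g h

/-- The induction principle for injections. -/
theorem arrow_induction {P : ∀ {X Y : FI.{w}}, (X ⟶ Y) → Prop}
    (of_iso : ∀ {X Y X' Y' : FI.{w}} {h : X ⟶ Y} {h' : X' ⟶ Y'} (c : X ≅ X') (d : Y ≅ Y'),
      h ≫ d.hom = c.hom ≫ h' → P h' → P h)
    (tensor : ∀ {X Y X' Y' : FI.{w}} {h : X ⟶ Y} {h' : X' ⟶ Y'}, P h → P h' → P (h ⊗ₘ h'))
    (unit : P (𝟙 (𝟙_ FI))) (pt₀ : P (𝟙 pt)) (pt₁ : P fromEmpty) {X Y : FI.{w}} (h : X ⟶ Y) :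
    P h :=
  pair_induction (P := fun _ h => P h) (fun _ c d _ hh => of_iso c d hh) tensor
    unit pt₀ pt₀ pt₁ (𝟙 X) h

/-- The induction principle for finite sets. -/
theorem object_induction {P : FI.{w} → Prop} (of_iso : ∀ {X Y : FI.{w}}, (X ≅ Y) → P Y → P X)
    (tensor : ∀ {X Y : FI.{w}}, P X → P Y → P (X ⊗ Y)) (unit : P (𝟙_ FI)) (pt : P pt)
    (X : FI.{w}) : P X :=
  arrow_induction (P := fun {_ Y} _ => P Y) (fun _ d _ => of_iso d) tensor unit pt pt (𝟙 X)

end FI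

/-! ## Morphisms of weak enrichment functors are determined by morphisms of pairs -/

namespace WeakEnrichmentFunctor

open Functor.LaxMonoidal Functor.OplaxMonoidal Functor.Monoidal

variable {E : Type u} [Category.{v} E] [MonoidalCategory E] [SymmetricCategory E]

omit [SymmetricCategory E] in
theorem natTrans_ext {D D' : IsoArrow FI.{w} ⥤ E} [D.Monoidal] [D'.Monoidal] {α β : D ⟶ D'}
    [NatTrans.IsMonoidal α] [NatTrans.IsMonoidal β] (hA : α.app ⟨𝟙 FI.pt⟩ = β.app ⟨𝟙 FI.pt⟩)
    (hM : α.app ⟨FI.fromEmpty⟩ = β.app ⟨FI.fromEmpty⟩) : α = β := by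
  ext ⟨f⟩
  refine FI.arrow_induction (P := fun f => α.app ⟨f⟩ = β.app ⟨f⟩) ?_ ?_ ?_ hA hM f
  · intro _ _ _ _ h h' c d e ih
    let i : (⟨h⟩ : IsoArrow FI) ≅ ⟨h'⟩ := IsoArrow.isoMk c d e
    rw [← cancel_mono (D'.map i.hom), ← α.naturality, ← β.naturality, ih]
  · intro _ _ _ _ h h' ih ih'
    have key : μ D ⟨h⟩ ⟨h'⟩ ≫ α.app (⟨h⟩ ⊗ ⟨h'⟩) = μ D ⟨h⟩ ⟨h'⟩ ≫ β.app (⟨h⟩ ⊗ ⟨h'⟩) := by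
      rw [NatTrans.IsMonoidal.tensor, NatTrans.IsMonoidal.tensor, ih, ih']
    exact (cancel_epi _).1 key
  · have key : ε D ≫ α.app (𝟙_ _) = ε D ≫ β.app (𝟙_ _) := by
      rw [NatTrans.IsMonoidal.unit, NatTrans.IsMonoidal.unit]
    exact (cancel_epi _).1 key

instance : (toPair.{w} E).Faithful where
  map_injective h := Hom.ext (natTrans_ext (congrArg MonoidModulePair.Hom.homA h)
    (congrArg MonoidModulePair.Hom.homM h))

section

variable {F : Type u'} [Category.{v'} F] [MonoidalCategory F] [SymmetricCategory F]

/-- Since the unit datum of the tensor unit is `ε`, which is invertible, the right unit law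
determines this composition. Hence the third generator of the triangles carries no information. -/
theorem comp_id_tensorUnit (P : WeakEnrichmentFunctor F E) {X : F} (f : 𝟙_ F ⟶ X)
    (h : 𝟙 (𝟙_ F) ≫ f = f) :
    P.comp (𝟙 (𝟙_ F)) f f h = P.D.obj ⟨f⟩ ◁ η P.D ≫ (ρ_ _).hom := by
  rw [← P.comp_unit f, P.unit_tensorUnit, ← Category.assoc, ← MonoidalCategory.whiskerLeft_comp]
  -- Arbitrary objects are used because the tensor unit of `IsoArrow F` is the arrow `𝟙 (𝟙_ F)` only
  -- after unfolding.
  have aux {A I C : E} {e : I ⟶ I} (he : e = 𝟙 I) (c : A ⊗ I ⟶ C) : c = A ◁ e ≫ c := by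
    rw [he, MonoidalCategory.whiskerLeft_id, Category.id_comp]
  exact aux (η_ε P.D) _

end

variable {P Q : WeakEnrichmentFunctor FI.{w} E}

theorem unit_natTrans (α : P.D ⟶ Q.D) [NatTrans.IsMonoidal α]
    (h : P.unit FI.pt ≫ α.app ⟨𝟙 FI.pt⟩ = Q.unit FI.pt) (X : FI) :
    P.unit X ≫ α.app ⟨𝟙 X⟩ = Q.unit X := by
  refine FI.object_induction (P := fun X => P.unit X ≫ α.app ⟨𝟙 X⟩ = Q.unit X) ?_ ?_ ?_ h X
  · intro X Y e ih
    rw [← P.unit_naturality e.symm, Category.assoc, α.naturality, reassoc_of% ih,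
      Q.unit_naturality]
  · intro X Y ihX ihY
    rw [← P.unit_tensor, ← Q.unit_tensor]
    simp only [Category.assoc, α.naturality]
    rw [NatTrans.IsMonoidal.tensor_assoc, tensorHom_comp_tensorHom_assoc, ihX, ihY]
  · rw [P.unit_tensorUnit, Q.unit_tensorUnit]
    exact NatTrans.IsMonoidal.unit

/-- Naturality and interchange reduce the claim to pairs of injections in the point: `hA` and `hM`
are two of them, and those starting with the identity of the empty set follow from
`comp_id_tensorUnit`. -/
theorem comp_natTrans (α : P.D ⟶ Q.D) [NatTrans.IsMonoidal α]
    (hA : P.comp (𝟙 FI.pt) (𝟙 FI.pt) (𝟙 FI.pt) (Category.comp_id _) ≫ α.app ⟨𝟙 FI.pt⟩ =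
      (α.app ⟨𝟙 FI.pt⟩ ⊗ₘ α.app ⟨𝟙 FI.pt⟩) ≫
        Q.comp (𝟙 FI.pt) (𝟙 FI.pt) (𝟙 FI.pt) (Category.comp_id _))
    (hM : P.comp FI.fromEmpty (𝟙 FI.pt) FI.fromEmpty (Category.comp_id _) ≫
        α.app ⟨FI.fromEmpty⟩ = (α.app ⟨𝟙 FI.pt⟩ ⊗ₘ α.app ⟨FI.fromEmpty⟩) ≫
        Q.comp FI.fromEmpty (𝟙 FI.pt) FI.fromEmpty (Category.comp_id _))
    {X Y Z : FI.{w}} (f : X ⟶ Y) (g : Y ⟶ Z) (h : X ⟶ Z) (t : f ≫ g = h) :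
    P.comp f g h t ≫ α.app ⟨h⟩ = (α.app ⟨g⟩ ⊗ₘ α.app ⟨f⟩) ≫ Q.comp f g h t := by
  have hU {X : FI.{w}} (f : 𝟙_ FI.{w} ⟶ X) (h : 𝟙_ FI.{w} ⟶ X) (t : 𝟙 (𝟙_ FI) ≫ f = h) :
      P.comp (𝟙 (𝟙_ FI)) f h t ≫ α.app ⟨h⟩ =
        (α.app ⟨f⟩ ⊗ₘ α.app ⟨𝟙 (𝟙_ FI)⟩) ≫ Q.comp (𝟙 (𝟙_ FI)) f h t := by
    obtain rfl : f = h := by rw [← t, Category.id_comp]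
    have hη : α.app ⟨𝟙 (𝟙_ FI)⟩ ≫ η Q.D = η P.D := by
      have key : ε P.D ≫ α.app (𝟙_ _) = ε Q.D := NatTrans.IsMonoidal.unit
      rw [← cancel_epi (ε P.D), ε_η]
      exact (Category.assoc _ _ _).symm.trans ((congrArg (· ≫ η Q.D) key).trans (ε_η Q.D))
    rw [comp_id_tensorUnit, comp_id_tensorUnit, MonoidalCategory.tensorHom_def, ← hη,
      MonoidalCategory.whiskerLeft_comp]
    simp only [Category.assoc]
    rw [← rightUnitor_naturality, whisker_exchange_assoc, whisker_exchange_assoc]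
    rfl
  refine FI.pair_induction (P := fun {X _ Z} f g => ∀ (h : X ⟶ Z) (t : f ≫ g = h),
    P.comp f g h t ≫ α.app ⟨h⟩ = (α.app ⟨g⟩ ⊗ₘ α.app ⟨f⟩) ≫ Q.comp f g h t)
    ?_ ?_ ?_ ?_ ?_ ?_ f g h t
  · intro X Y Z X' Y' Z' f g f' g' x y z hf hg ih h t
    let h' : X' ⟶ Z' := f' ≫ g'
    let i : (⟨f⟩ : IsoArrow FI) ≅ ⟨f'⟩ := IsoArrow.isoMk x y hf
    let j : (⟨g⟩ : IsoArrow FI) ≅ ⟨g'⟩ := IsoArrow.isoMk y z hg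
    let k : (⟨h⟩ : IsoArrow FI) ≅ ⟨h'⟩ := IsoArrow.isoMk x z (by
      dsimp only [h']
      rw [← t, Category.assoc, hg, reassoc_of% hf])
    have n₁ := P.comp_naturality t (rfl : f' ≫ g' = h') i.hom j.hom k.hom rfl rfl rfl
    have n₂ := Q.comp_naturality t (rfl : f' ≫ g' = h') i.hom j.hom k.hom rfl rfl rfl
    rw [← cancel_mono (Q.D.map k.hom), Category.assoc, Category.assoc, ← n₂,
      tensorHom_comp_tensorHom_assoc, ← α.naturality, ← α.naturality, ← α.naturality,
      ← tensorHom_comp_tensorHom_assoc, ← reassoc_of% n₁, ih h' rfl]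
  · intro X Y Z X' Y' Z' f g f' g' ih ih' h t
    rw [tensorHom_comp_tensorHom] at t
    subst t
    have n₁ := P.comp_tensor (rfl : f ≫ g = _) (rfl : f' ≫ g' = _)
    have n₂ := Q.comp_tensor (rfl : f ≫ g = _) (rfl : f' ≫ g' = _)
    have hμ {A B C D : FI.{w}} (f : A ⟶ B) (g : C ⟶ D) :
        μ P.D ⟨f⟩ ⟨g⟩ ≫ α.app ⟨f ⊗ₘ g⟩ = (α.app ⟨f⟩ ⊗ₘ α.app ⟨g⟩) ≫ μ Q.D ⟨f⟩ ⟨g⟩ :=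
      NatTrans.IsMonoidal.tensor (⟨f⟩ : IsoArrow FI) ⟨g⟩
    have : Epi (μ P.D ⟨g⟩ ⟨g'⟩ ⊗ₘ μ P.D ⟨f⟩ ⟨f'⟩) := inferInstance
    refine (cancel_epi (μ P.D ⟨g⟩ ⟨g'⟩ ⊗ₘ μ P.D ⟨f⟩ ⟨f'⟩)).1 ?_
    rw [reassoc_of% n₁]
    refine .trans ?_ (tensorHom_comp_tensorHom_assoc _ _ _ _ _).symm
    rw [hμ, hμ, hμ, ← tensorHom_comp_tensorHom_assoc, n₂, tensorHom_comp_tensorHom_assoc,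
      ih _ rfl, ih' _ rfl, ← tensorHom_comp_tensorHom_assoc, tensorμ_natural_assoc]
  · exact hU _
  · intro h t
    obtain rfl : 𝟙 _ = h := by rw [← t, Category.id_comp]
    exact hA
  · intro h t
    obtain rfl : FI.fromEmpty = h := by rw [← t, Category.comp_id]
    exact hM
  · exact hU _

instance : (toPair.{w} E).Full where
  map_surjective {P Q} a := by
    obtain ⟨α, hα, h⟩ := IsoArrow.freelyGenerates_generator.exists_natTrans P.D Q.D
      (fun b => match b with
        | true => a.homA
        | false => a.homM)
    have hA : α.app ⟨𝟙 FI.pt⟩ = a.homA := h true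
    have hM : α.app ⟨FI.fromEmpty⟩ = a.homM := h false
    refine ⟨{ nat := α, comp_nat := comp_natTrans α ?_ ?_, unit_nat := unit_natTrans α ?_ },
      MonoidModulePair.hom_ext hA hM⟩
    · rw [hA]
      exact a.isMonHom.mul_hom
    · rw [hA, hM]
      exact a.smul_hom
    · rw [hA]
      exact a.isMonHom.one_hom

end WeakEnrichmentFunctor

/-! ## Interchange relations -/

section Interchange

variable {E : Type u} [Category.{v} E] [MonoidalCategory E] [SymmetricCategory E]

theorem tensorμ_tensorμ (X₁ X₂ Y₁ Y₂ : E) : tensorμ X₁ X₂ Y₁ Y₂ ≫ tensorμ X₁ Y₁ X₂ Y₂ = 𝟙 _ := by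
  have h : tensorμ X₁ Y₁ X₂ Y₂ = tensorδ X₁ X₂ Y₁ Y₂ := by
    rw [tensorμ, tensorδ, SymmetricCategory.braiding_swap_eq_inv_braiding]
  rw [h, tensorμ_tensorδ]

/-- If two associative triples of pairings satisfy interchange relations with a third triple of
pairings, then the latter is associative. -/
theorem assoc_of_interchange {X Y Z XY YZ XYZ X' Y' Z' XY' YZ' XYZ' X'' Y'' Z'' XY'' YZ'' XYZ'' : E}
    {a : X ⊗ Y ⟶ XY} {b : XY ⊗ Z ⟶ XYZ} {c : Y ⊗ Z ⟶ YZ} {d : X ⊗ YZ ⟶ XYZ}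
    {a' : X' ⊗ Y' ⟶ XY'} {b' : XY' ⊗ Z' ⟶ XYZ'} {c' : Y' ⊗ Z' ⟶ YZ'} {d' : X' ⊗ YZ' ⟶ XYZ'}
    {a'' : X'' ⊗ Y'' ⟶ XY''} {b'' : XY'' ⊗ Z'' ⟶ XYZ''} {c'' : Y'' ⊗ Z'' ⟶ YZ''}
    {d'' : X'' ⊗ YZ'' ⟶ XYZ''}
    (x : X ⊗ X' ⟶ X'') (y : Y ⊗ Y' ⟶ Y'') (z : Z ⊗ Z' ⟶ Z'') (xy : XY ⊗ XY' ⟶ XY'')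
    (yz : YZ ⊗ YZ' ⟶ YZ'') (xyz : XYZ ⊗ XYZ' ⟶ XYZ'') [IsIso x] [IsIso y] [IsIso z]
    (ha : (x ⊗ₘ y) ≫ a'' = tensorμ _ _ _ _ ≫ (a ⊗ₘ a') ≫ xy)
    (hb : (xy ⊗ₘ z) ≫ b'' = tensorμ _ _ _ _ ≫ (b ⊗ₘ b') ≫ xyz)
    (hc : (y ⊗ₘ z) ≫ c'' = tensorμ _ _ _ _ ≫ (c ⊗ₘ c') ≫ yz)
    (hd : (x ⊗ₘ yz) ≫ d'' = tensorμ _ _ _ _ ≫ (d ⊗ₘ d') ≫ xyz)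
    (h : a ▷ Z ≫ b = (α_ _ _ _).hom ≫ X ◁ c ≫ d)
    (h' : a' ▷ Z' ≫ b' = (α_ _ _ _).hom ≫ X' ◁ c' ≫ d') :
    a'' ▷ Z'' ≫ b'' = (α_ _ _ _).hom ≫ X'' ◁ c'' ≫ d'' := by
  -- After precomposing with these isomorphisms, both sides become tensor products of the given
  -- composites, and `tensor_associativity` matches the shuffles.
  rw [← cancel_epi ((x ⊗ₘ y) ⊗ₘ z), associator_naturality_assoc]
  have e₁ : ((x ⊗ₘ y) ⊗ₘ z) ≫ a'' ▷ Z'' ≫ b'' = tensorμ X X' Y Y' ▷ (Z ⊗ Z') ≫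
      tensorμ (X ⊗ Y) (X' ⊗ Y') Z Z' ≫ ((a ▷ Z ≫ b) ⊗ₘ (a' ▷ Z' ≫ b')) ≫ xyz := by
    rw [← tensorHom_comp_tensorHom, Category.assoc, ← tensorμ_natural_left_assoc, ← hb]
    simp only [← tensorHom_id, tensorHom_comp_tensorHom_assoc, Category.comp_id, Category.id_comp,
      ha]
  have e₂ : (x ⊗ₘ y ⊗ₘ z) ≫ X'' ◁ c'' ≫ d'' = (X ⊗ X') ◁ tensorμ Y Y' Z Z' ≫
      tensorμ X X' (Y ⊗ Z) (Y' ⊗ Z') ≫ ((X ◁ c ≫ d) ⊗ₘ (X' ◁ c' ≫ d')) ≫ xyz := by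
    rw [← tensorHom_comp_tensorHom, Category.assoc, ← tensorμ_natural_right_assoc, ← hd]
    simp only [← id_tensorHom, tensorHom_comp_tensorHom_assoc, Category.comp_id, Category.id_comp,
      hc]
  rw [e₁, e₂, h, h', ← tensor_associativity_assoc, ← tensorHom_comp_tensorHom, Category.assoc]

theorem leftUnit_of_interchange {U X U' X' U'' X'' : E} {u : 𝟙_ E ⟶ U} {u' : 𝟙_ E ⟶ U'}
    {c : U ⊗ X ⟶ X} {c' : U' ⊗ X' ⟶ X'} {c'' : U'' ⊗ X'' ⟶ X''} (m : U ⊗ U' ⟶ U'')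
    (x : X ⊗ X' ⟶ X'') [IsIso x] (hc : (m ⊗ₘ x) ≫ c'' = tensorμ _ _ _ _ ≫ (c ⊗ₘ c') ≫ x)
    (h : u ▷ X ≫ c = (λ_ X).hom) (h' : u' ▷ X' ≫ c' = (λ_ X').hom) :
    ((λ_ (𝟙_ E)).inv ≫ (u ⊗ₘ u') ≫ m) ▷ X'' ≫ c'' = (λ_ X'').hom := by
  rw [← cancel_epi (𝟙_ E ◁ x), leftUnitor_naturality, tensor_left_unitality, ← h, ← h',
    ← tensorHom_comp_tensorHom]
  simp only [Category.assoc]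
  rw [← tensorμ_natural_left_assoc, ← hc]
  simp only [← tensorHom_id, ← id_tensorHom, tensorHom_comp_tensorHom_assoc, Category.comp_id,
    Category.id_comp]

theorem rightUnit_of_interchange {U X U' X' U'' X'' : E} {u : 𝟙_ E ⟶ U} {u' : 𝟙_ E ⟶ U'}
    {c : X ⊗ U ⟶ X} {c' : X' ⊗ U' ⟶ X'} {c'' : X'' ⊗ U'' ⟶ X''} (m : U ⊗ U' ⟶ U'')
    (x : X ⊗ X' ⟶ X'') [IsIso x] (hc : (x ⊗ₘ m) ≫ c'' = tensorμ _ _ _ _ ≫ (c ⊗ₘ c') ≫ x)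
    (h : X ◁ u ≫ c = (ρ_ X).hom) (h' : X' ◁ u' ≫ c' = (ρ_ X').hom) :
    X'' ◁ ((λ_ (𝟙_ E)).inv ≫ (u ⊗ₘ u') ≫ m) ≫ c'' = (ρ_ X'').hom := by
  rw [← cancel_epi (x ▷ 𝟙_ E), rightUnitor_naturality, tensor_right_unitality, ← h, ← h',
    ← tensorHom_comp_tensorHom]
  simp only [Category.assoc]
  rw [← tensorμ_natural_right_assoc, ← hc]
  simp only [← tensorHom_id, ← id_tensorHom, tensorHom_comp_tensorHom_assoc, Category.comp_id,
    Category.id_comp]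

end Interchange

/-- Used up to definitional equality to remove the factors `D.map (𝟙 _)` that come from structure
maps of composite functors, and composites of an isomorphism with its inverse. -/
theorem comp_of_eq_id {E : Type u} [Category.{v} E] {X Y : E} {f : X ⟶ Y} {g : Y ⟶ Y}
    (hg : g = 𝟙 Y) : f ≫ g = f := by
  rw [hg, Category.comp_id]

/-! ## Composition and unit data without associativity and unit laws -/

section

open Functor.LaxMonoidal Functor.OplaxMonoidal Functor.Monoidal

variable {F : Type u'} [Category.{v'} F] [MonoidalCategory F] [SymmetricCategory F]
variable {E : Type u} [Category.{v} E] [MonoidalCategory E] [SymmetricCategory E]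

/-- Composition data for a functor on `Iso(F ↓ F)`, without associativity. -/
structure CompositionData (D : IsoArrow F ⥤ E) [D.Braided] where
  /-- The composition data. -/
  comp {X Y Z : F} (f : X ⟶ Y) (g : Y ⟶ Z) (h : X ⟶ Z) (t : f ≫ g = h) :
    D.obj ⟨g⟩ ⊗ D.obj ⟨f⟩ ⟶ D.obj ⟨h⟩
  naturality {X Y Z X' Y' Z' : F} {f : X ⟶ Y} {g : Y ⟶ Z} {h : X ⟶ Z}
    {f' : X' ⟶ Y'} {g' : Y' ⟶ Z'} {h' : X' ⟶ Z'} (t : f ≫ g = h) (t' : f' ≫ g' = h')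
    (a : (⟨f⟩ : IsoArrow F) ⟶ ⟨f'⟩) (b : (⟨g⟩ : IsoArrow F) ⟶ ⟨g'⟩)
    (c : (⟨h⟩ : IsoArrow F) ⟶ ⟨h'⟩)
    (hab : a.right = b.left) (hac : c.left = a.left) (hbc : c.right = b.right) :
    (D.map b ⊗ₘ D.map a) ≫ comp f' g' h' t' = comp f g h t ≫ D.map c
  tensor {X Y Z X' Y' Z' : F} {f : X ⟶ Y} {g : Y ⟶ Z} {h : X ⟶ Z}
    {f' : X' ⟶ Y'} {g' : Y' ⟶ Z'} {h' : X' ⟶ Z'} (t : f ≫ g = h) (t' : f' ≫ g' = h') :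
    (μ D ⟨g⟩ ⟨g'⟩ ⊗ₘ μ D ⟨f⟩ ⟨f'⟩) ≫
        comp (f ⊗ₘ f') (g ⊗ₘ g') (h ⊗ₘ h')
          (by rw [MonoidalCategory.tensorHom_comp_tensorHom, t, t']) =
      MonoidalCategory.tensorμ _ _ _ _ ≫ (comp f g h t ⊗ₘ comp f' g' h' t') ≫ μ D ⟨h⟩ ⟨h'⟩
  tensorUnit : (ε D ⊗ₘ ε D) ≫ comp (𝟙 (𝟙_ F)) (𝟙 (𝟙_ F)) (𝟙 (𝟙_ F)) (Category.comp_id _) =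
    (λ_ (𝟙_ E)).hom ≫ ε D

/-- Unit data for a functor on `Iso(F ↓ F)`. -/
structure UnitData (D : IsoArrow F ⥤ E) [D.Braided] where
  /-- The unit data. -/
  unit (X : F) : 𝟙_ E ⟶ D.obj ⟨𝟙 X⟩
  naturality {X X' : F} (σ : X ≅ X') : unit X ≫ D.map (IsoArrow.idSquare σ) = unit X'
  tensor (X Y : F) :
    (λ_ (𝟙_ E)).inv ≫ (unit X ⊗ₘ unit Y) ≫ μ D ⟨𝟙 X⟩ ⟨𝟙 Y⟩ ≫
      D.map (IsoArrow.ofEq (MonoidalCategory.id_tensorHom_id X Y)) = unit (X ⊗ Y)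
  tensorUnit : unit (𝟙_ F) = ε D

/-- Composition data from a monoidal natural transformation on triangles. -/
def CompositionData.ofNatTrans (D : IsoArrow F ⥤ E) [D.Braided]
    (α : tensorFunctor (Triangle.sndFunctor F ⋙ D) (Triangle.fstFunctor F ⋙ D) ⟶
      Triangle.compFunctor F ⋙ D) [NatTrans.IsMonoidal α] : CompositionData D where
  comp f g h t := α.app ⟨f, g, h, t⟩
  naturality {_ _ _ _ _ _ f g h f' g' h'} t t' a b c hab hac hbc :=
    α.naturality (X := ⟨f, g, h, t⟩) (Y := ⟨f', g', h', t'⟩) ⟨a, b, c, hab, hac, hbc⟩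
  tensor {_ _ _ _ _ _ f g h f' g' h'} t t' := by
    have key := NatTrans.IsMonoidal.tensor (τ := α) ⟨f, g, h, t⟩ ⟨f', g', h', t'⟩
    rw [tensorFunctor_μ] at key
    -- Monoidality of `α` has the shuffle on the other side of the interchange relation; it is moved
    -- across because shuffles are inverse to each other in a symmetric category.
    have aux {X₁ X₂ Y₁ Y₂ X Y Z : E} {x x' : X₁ ⊗ Y₁ ⟶ X} {y y' : X₂ ⊗ Y₂ ⟶ Y} {c : X ⊗ Y ⟶ Z}
        {c' : (X₁ ⊗ X₂) ⊗ (Y₁ ⊗ Y₂) ⟶ Z} (hx : x = x') (hy : y = y')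
        (h : (tensorμ _ _ _ _ ≫ (x ⊗ₘ y)) ≫ c = c') :
        (x' ⊗ₘ y') ≫ c = tensorμ _ _ _ _ ≫ c' := by
      rw [← h, Category.assoc, ← Category.assoc, tensorμ_tensorμ, Category.id_comp, hx, hy]
    refine (aux (comp_of_eq_id (D.map_id _)) (comp_of_eq_id (D.map_id _)) key).trans ?_
    exact congrArg (fun r => tensorμ _ _ _ _ ≫ (_ ⊗ₘ _) ≫ r) (comp_of_eq_id (D.map_id _))
  tensorUnit := by
    have key := NatTrans.IsMonoidal.unit (τ := α)
    rw [tensorFunctor_ε] at key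
    have aux {X Y : E} {x x' : 𝟙_ E ⟶ X} {c : X ⊗ X ⟶ Y} {e e' : 𝟙_ E ⟶ Y} (hx : x = x')
        (he : e = e') (h : ((λ_ (𝟙_ E)).inv ≫ (x ⊗ₘ x)) ≫ c = e) :
        (x' ⊗ₘ x') ≫ c = (λ_ (𝟙_ E)).hom ≫ e' := by
      rw [← he, ← h, hx, Category.assoc, Iso.hom_inv_id_assoc]
    exact aux (comp_of_eq_id (D.map_id _)) (comp_of_eq_id (D.map_id _)) key

variable {D : IsoArrow F ⥤ E} [D.Braided]

namespace CompositionData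

variable (C : CompositionData D)

/-- The composition data is associative at a chain. -/
def IsAssoc {W X Y Z : F} (f : W ⟶ X) (g : X ⟶ Y) (h : Y ⟶ Z) : Prop :=
  ∀ ⦃fg : W ⟶ Y⦄ ⦃gh : X ⟶ Z⦄ ⦃fgh : W ⟶ Z⦄ (t₁ : f ≫ g = fg) (t₂ : g ≫ h = gh)
    (t₃ : f ≫ gh = fgh) (t₄ : fg ≫ h = fgh),
    C.comp g h gh t₂ ▷ D.obj ⟨f⟩ ≫ C.comp f gh fgh t₃ =
      (α_ _ _ _).hom ≫ D.obj ⟨h⟩ ◁ C.comp f g fg t₁ ≫ C.comp fg h fgh t₄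

variable {C}

theorem IsAssoc.of_iso {W X Y Z W' X' Y' Z' : F} {f : W ⟶ X} {g : X ⟶ Y} {h : Y ⟶ Z}
    {f' : W' ⟶ X'} {g' : X' ⟶ Y'} {h' : Y' ⟶ Z'} (w : W ≅ W') (x : X ≅ X') (y : Y ≅ Y')
    (z : Z ≅ Z') (hf : f ≫ x.hom = w.hom ≫ f') (hg : g ≫ y.hom = x.hom ≫ g')
    (hh : h ≫ z.hom = y.hom ≫ h') (H : C.IsAssoc f' g' h') : C.IsAssoc f g h := by
  rintro fg gh fgh rfl rfl rfl t₄
  let i : (⟨f⟩ : IsoArrow F) ≅ ⟨f'⟩ := IsoArrow.isoMk w x hf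
  let j : (⟨g⟩ : IsoArrow F) ≅ ⟨g'⟩ := IsoArrow.isoMk x y hg
  let k : (⟨h⟩ : IsoArrow F) ≅ ⟨h'⟩ := IsoArrow.isoMk y z hh
  let ij : (⟨f ≫ g⟩ : IsoArrow F) ≅ ⟨f' ≫ g'⟩ := IsoArrow.isoMk w y (by
    simp only [Category.assoc, hg, reassoc_of% hf])
  let jk : (⟨g ≫ h⟩ : IsoArrow F) ≅ ⟨g' ≫ h'⟩ := IsoArrow.isoMk x z (by
    simp only [Category.assoc, hh, reassoc_of% hg])
  let ijk : (⟨f ≫ g ≫ h⟩ : IsoArrow F) ≅ ⟨f' ≫ g' ≫ h'⟩ := IsoArrow.isoMk w z (by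
    simp only [Category.assoc, hh, reassoc_of% hg, reassoc_of% hf])
  have n₁ := C.naturality (rfl : f ≫ g = _) (rfl : f' ≫ g' = _) i.hom j.hom ij.hom rfl rfl rfl
  have n₂ := C.naturality (rfl : g ≫ h = _) (rfl : g' ≫ h' = _) j.hom k.hom jk.hom rfl rfl rfl
  have n₃ := C.naturality (rfl : f ≫ g ≫ h = _) (rfl : f' ≫ g' ≫ h' = _) i.hom jk.hom ijk.hom
    rfl rfl rfl
  have n₄ := C.naturality t₄ (Category.assoc f' g' h') ij.hom k.hom ijk.hom rfl rfl rfl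
  have H' := H rfl rfl rfl (Category.assoc f' g' h')
  rw [← cancel_mono (D.map ijk.hom)]
  simp only [Category.assoc]
  have e₁ : C.comp g h _ rfl ▷ D.obj ⟨f⟩ ≫ (D.map jk.hom ⊗ₘ D.map i.hom) =
      ((D.map k.hom ⊗ₘ D.map j.hom) ⊗ₘ D.map i.hom) ≫ C.comp g' h' _ rfl ▷ D.obj ⟨f'⟩ := by
    rw [← tensorHom_id, ← tensorHom_id, tensorHom_comp_tensorHom, tensorHom_comp_tensorHom, n₂,
      Category.id_comp, Category.comp_id]
  have e₂ : D.obj ⟨h⟩ ◁ C.comp f g _ rfl ≫ (D.map k.hom ⊗ₘ D.map ij.hom) =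
      (D.map k.hom ⊗ₘ D.map j.hom ⊗ₘ D.map i.hom) ≫ D.obj ⟨h'⟩ ◁ C.comp f' g' _ rfl := by
    rw [← id_tensorHom, ← id_tensorHom, tensorHom_comp_tensorHom, tensorHom_comp_tensorHom, n₁,
      Category.id_comp, Category.comp_id]
  rw [← n₃, ← n₄, reassoc_of% e₁, reassoc_of% e₂, H', associator_naturality_assoc]

theorem IsAssoc.tensor {W X Y Z W' X' Y' Z' : F} {f : W ⟶ X} {g : X ⟶ Y} {h : Y ⟶ Z}
    {f' : W' ⟶ X'} {g' : X' ⟶ Y'} {h' : Y' ⟶ Z'} (H : C.IsAssoc f g h)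
    (H' : C.IsAssoc f' g' h') : C.IsAssoc (f ⊗ₘ f') (g ⊗ₘ g') (h ⊗ₘ h') := by
  intro fg gh fgh t₁ t₂ t₃ t₄
  rw [tensorHom_comp_tensorHom] at t₁ t₂
  subst t₁ t₂
  rw [tensorHom_comp_tensorHom] at t₃
  subst t₃
  exact assoc_of_interchange (μ D ⟨h⟩ ⟨h'⟩) (μ D ⟨g⟩ ⟨g'⟩) (μ D ⟨f⟩ ⟨f'⟩) (μ D ⟨g ≫ h⟩ ⟨g' ≫ h'⟩)
    (μ D ⟨f ≫ g⟩ ⟨f' ≫ g'⟩) (μ D ⟨f ≫ g ≫ h⟩ ⟨f' ≫ g' ≫ h'⟩) (C.tensor rfl rfl)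
    (C.tensor rfl rfl) (C.tensor rfl rfl) (C.tensor (Category.assoc _ _ _) (Category.assoc _ _ _))
    (H rfl rfl rfl (Category.assoc _ _ _)) (H' rfl rfl rfl (Category.assoc _ _ _))

/-- Composing with the identity of the tensor unit only discards a factor through `η`, so both
bracketings reduce to the composition of `g` and `h`. -/
theorem IsAssoc.of_comp_id_tensorUnit
    (hC : ∀ {X : F} (f : 𝟙_ F ⟶ X), C.comp (𝟙 (𝟙_ F)) f f (Category.id_comp _) =
      D.obj ⟨f⟩ ◁ η D ≫ (ρ_ _).hom) {X Y : F} (g : 𝟙_ F ⟶ X) (h : X ⟶ Y) :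
    C.IsAssoc (𝟙 (𝟙_ F)) g h := by
  intro fg gh fgh t₁ t₂ t₃ t₄
  obtain rfl : g = fg := by rw [← t₁, Category.id_comp]
  obtain rfl : gh = fgh := by rw [← t₃, Category.id_comp]
  rw [hC, hC]
  have aux {A B X Y : E} (c : A ⊗ B ⟶ X) (e : Y ⟶ 𝟙_ E) : c ▷ Y ≫ X ◁ e ≫ (ρ_ X).hom =
      (α_ A B Y).hom ≫ A ◁ (B ◁ e ≫ (ρ_ B).hom) ≫ c := by
    rw [← whisker_exchange_assoc, rightUnitor_naturality]
    simp
  exact aux _ _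

end CompositionData

theorem UnitData.leftUnit_of_iso {C : CompositionData D} (U : UnitData D) {X Y X' Y' : F}
    {f : X ⟶ Y} {f' : X' ⟶ Y'} (x : X ≅ X') (y : Y ≅ Y') (hf : f ≫ y.hom = x.hom ≫ f')
    (H : U.unit Y' ▷ D.obj ⟨f'⟩ ≫ C.comp f' (𝟙 Y') f' (Category.comp_id f') = (λ_ _).hom) :
    U.unit Y ▷ D.obj ⟨f⟩ ≫ C.comp f (𝟙 Y) f (Category.comp_id f) = (λ_ _).hom := by
  let i : (⟨f⟩ : IsoArrow F) ≅ ⟨f'⟩ := IsoArrow.isoMk x y hf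
  have n := C.naturality (Category.comp_id f) (Category.comp_id f') i.hom (IsoArrow.idSquare y)
    i.hom rfl rfl rfl
  rw [← cancel_mono (D.map i.hom), Category.assoc, ← n, ← leftUnitor_naturality, ← H,
    ← U.naturality y]
  simp only [← tensorHom_id, ← id_tensorHom, tensorHom_comp_tensorHom_assoc, Category.comp_id,
    Category.id_comp]

theorem UnitData.rightUnit_of_iso {C : CompositionData D} (U : UnitData D) {X Y X' Y' : F}
    {f : X ⟶ Y} {f' : X' ⟶ Y'} (x : X ≅ X') (y : Y ≅ Y') (hf : f ≫ y.hom = x.hom ≫ f')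
    (H : D.obj ⟨f'⟩ ◁ U.unit X' ≫ C.comp (𝟙 X') f' f' (Category.id_comp f') = (ρ_ _).hom) :
    D.obj ⟨f⟩ ◁ U.unit X ≫ C.comp (𝟙 X) f f (Category.id_comp f) = (ρ_ _).hom := by
  let i : (⟨f⟩ : IsoArrow F) ≅ ⟨f'⟩ := IsoArrow.isoMk x y hf
  have n := C.naturality (Category.id_comp f) (Category.id_comp f') (IsoArrow.idSquare x) i.hom
    i.hom rfl rfl rfl
  rw [← cancel_mono (D.map i.hom), Category.assoc, ← n, ← rightUnitor_naturality, ← H,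
    ← U.naturality x]
  simp only [← tensorHom_id, ← id_tensorHom, tensorHom_comp_tensorHom_assoc, Category.comp_id,
    Category.id_comp]

theorem UnitData.leftUnit_tensor {C : CompositionData D} (U : UnitData D) {X Y X' Y' : F}
    {f : X ⟶ Y} {f' : X' ⟶ Y'}
    (H : U.unit Y ▷ D.obj ⟨f⟩ ≫ C.comp f (𝟙 Y) f (Category.comp_id f) = (λ_ _).hom)
    (H' : U.unit Y' ▷ D.obj ⟨f'⟩ ≫ C.comp f' (𝟙 Y') f' (Category.comp_id f') = (λ_ _).hom) :
    U.unit (Y ⊗ Y') ▷ D.obj ⟨f ⊗ₘ f'⟩ ≫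
      C.comp (f ⊗ₘ f') (𝟙 (Y ⊗ Y')) (f ⊗ₘ f') (Category.comp_id _) = (λ_ _).hom := by
  -- The unit datum lives over `𝟙 (Y ⊗ Y')`, the interchange relation over `𝟙 Y ⊗ₘ 𝟙 Y'`; naturality
  -- along `IsoArrow.ofEq` connects them.
  have n := C.naturality (f := f ⊗ₘ f') (g := 𝟙 Y ⊗ₘ 𝟙 Y') (h := f ⊗ₘ f')
    (by rw [tensorHom_comp_tensorHom, Category.comp_id, Category.comp_id]) (Category.comp_id _)
    (𝟙 _) (IsoArrow.ofEq (id_tensorHom_id Y Y')) (𝟙 _) rfl rfl rfl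
  rw [D.map_id, Category.comp_id, tensorHom_id (D.map _)] at n
  have aux {K L M N X Y : E} {k : 𝟙_ E ⟶ K} {l : K ⟶ L} {m : L ⟶ M} {d : M ⟶ N} {c : N ⊗ X ⟶ Y}
      {c' : M ⊗ X ⟶ Y} {r : 𝟙_ E ⊗ X ⟶ Y} (n : d ▷ X ≫ c = c') (h : (k ≫ l ≫ m) ▷ X ≫ c' = r) :
      (k ≫ l ≫ m ≫ d) ▷ X ≫ c = r := by
    rw [← h, ← n]
    simp only [comp_whiskerRight, Category.assoc]
  rw [← U.tensor]
  exact aux n (leftUnit_of_interchange (μ D ⟨𝟙 Y⟩ ⟨𝟙 Y'⟩) (μ D ⟨f⟩ ⟨f'⟩)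
    (C.tensor (Category.comp_id f) (Category.comp_id f')) H H')

theorem UnitData.rightUnit_tensor {C : CompositionData D} (U : UnitData D) {X Y X' Y' : F}
    {f : X ⟶ Y} {f' : X' ⟶ Y'}
    (H : D.obj ⟨f⟩ ◁ U.unit X ≫ C.comp (𝟙 X) f f (Category.id_comp f) = (ρ_ _).hom)
    (H' : D.obj ⟨f'⟩ ◁ U.unit X' ≫ C.comp (𝟙 X') f' f' (Category.id_comp f') = (ρ_ _).hom) :
    D.obj ⟨f ⊗ₘ f'⟩ ◁ U.unit (X ⊗ X') ≫
      C.comp (𝟙 (X ⊗ X')) (f ⊗ₘ f') (f ⊗ₘ f') (Category.id_comp _) = (ρ_ _).hom := by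
  have n := C.naturality (f := 𝟙 X ⊗ₘ 𝟙 X') (g := f ⊗ₘ f') (h := f ⊗ₘ f')
    (by rw [tensorHom_comp_tensorHom, Category.id_comp, Category.id_comp]) (Category.id_comp _)
    (IsoArrow.ofEq (id_tensorHom_id X X')) (𝟙 _) (𝟙 _) rfl rfl rfl
  rw [D.map_id, Category.comp_id, id_tensorHom _ (D.map _)] at n
  have aux {K L M N X Y : E} {k : 𝟙_ E ⟶ K} {l : K ⟶ L} {m : L ⟶ M} {d : M ⟶ N} {c : X ⊗ N ⟶ Y}
      {c' : X ⊗ M ⟶ Y} {r : X ⊗ 𝟙_ E ⟶ Y} (n : X ◁ d ≫ c = c') (h : X ◁ (k ≫ l ≫ m) ≫ c' = r) :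
      X ◁ (k ≫ l ≫ m ≫ d) ≫ c = r := by
    rw [← h, ← n]
    simp only [MonoidalCategory.whiskerLeft_comp, Category.assoc]
  rw [← U.tensor]
  exact aux n (rightUnit_of_interchange (μ D ⟨𝟙 X⟩ ⟨𝟙 X'⟩) (μ D ⟨f⟩ ⟨f'⟩)
    (C.tensor (Category.id_comp f) (Category.id_comp f')) H H')

theorem UnitData.leftUnit_tensorUnit (C : CompositionData D) (U : UnitData D) :
    U.unit (𝟙_ F) ▷ D.obj ⟨𝟙 (𝟙_ F)⟩ ≫
      C.comp (𝟙 (𝟙_ F)) (𝟙 (𝟙_ F)) (𝟙 (𝟙_ F)) (Category.comp_id _) = (λ_ _).hom := by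
  have key {A : E} {e : 𝟙_ E ⟶ A} [IsIso e] {c : A ⊗ A ⟶ A}
      (h : (e ⊗ₘ e) ≫ c = (λ_ (𝟙_ E)).hom ≫ e) : e ▷ A ≫ c = (λ_ A).hom := by
    rw [← cancel_epi (𝟙_ E ◁ e), leftUnitor_naturality, ← h, tensorHom_def', Category.assoc]
  rw [U.tensorUnit]
  exact key C.tensorUnit

theorem UnitData.rightUnit_tensorUnit (C : CompositionData D) (U : UnitData D) :
    D.obj ⟨𝟙 (𝟙_ F)⟩ ◁ U.unit (𝟙_ F) ≫
      C.comp (𝟙 (𝟙_ F)) (𝟙 (𝟙_ F)) (𝟙 (𝟙_ F)) (Category.comp_id _) = (ρ_ _).hom := by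
  have key {A : E} {e : 𝟙_ E ⟶ A} [IsIso e] {c : A ⊗ A ⟶ A}
      (h : (e ⊗ₘ e) ≫ c = (λ_ (𝟙_ E)).hom ≫ e) : A ◁ e ≫ c = (ρ_ A).hom := by
    rw [← cancel_epi (e ▷ 𝟙_ E), rightUnitor_naturality, ← unitors_equal, ← h,
      MonoidalCategory.tensorHom_def, Category.assoc]
  rw [U.tensorUnit]
  exact key C.tensorUnit

end

/-! ## The weak enrichment functor of a pair -/

section

open Functor.LaxMonoidal Functor.OplaxMonoidal Functor.Monoidal

variable {E : Type u} [Category.{v} E] [MonoidalCategory E] [SymmetricCategory E]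

variable (E) in
/-- The constant functor with value the tensor unit. -/
abbrev constTensorUnit (B : Type u') [Category.{v'} B] : B ⥤ E := (Functor.const B).obj (𝟙_ E)

instance (B : Type u') [Category.{v'} B] [MonoidalCategory B] [SymmetricCategory B] :
    (constTensorUnit E B).Braided where
  toMonoidal := Functor.CoreMonoidal.toMonoidal
    { εIso := Iso.refl (𝟙_ E)
      μIso _ _ := λ_ (𝟙_ E)
      μIso_hom_natural_left _ _ := by simp
      μIso_hom_natural_right _ _ := by simp
      associativity _ _ _ := by simp [unitors_equal]
      left_unitality _ := by simp
      right_unitality _ := by simp [unitors_equal] }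
  braided _ _ := by
    have : (λ_ (𝟙_ E)).hom ≫ 𝟙 (𝟙_ E) = (β_ (𝟙_ E) (𝟙_ E)).hom ≫ (λ_ (𝟙_ E)).hom := by
      rw [braiding_leftUnitor, unitors_equal, Category.comp_id]
    exact this

/-! ### Existence of unit and composition data with prescribed values. -/

namespace FI

/-- Unit data is obtained from a monoidal transformation from the constant functor to `idArrow ⋙ D`,
and finite sets with bijections are freely generated by the point. -/
theorem exists_unitData (D : IsoArrow FI.{w} ⥤ E) [D.Braided] (u : 𝟙_ E ⟶ D.obj ⟨𝟙 pt⟩) :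
    ∃ U : UnitData D, U.unit pt = u := by
  obtain ⟨α, hα, h⟩ := (ColoredSet.freelyGenerates_point (C := Unit)).exists_natTrans
    (constTensorUnit E (ColoredSet.{w} Unit)) (idArrow ⋙ D) (fun _ => u)
  refine ⟨{ unit := fun X => α.app ⟨X.carrier, fun _ => ()⟩, naturality := ?_, tensor := ?_,
            tensorUnit := ?_ }, h ()⟩
  · intro X Y σ
    have := α.naturality (X := ⟨X.carrier, fun _ => ()⟩) (Y := ⟨Y.carrier, fun _ => ()⟩)
      ⟨equivOfIso σ, fun _ => rfl⟩
    refine Eq.trans ?_ (this.symm.trans (Category.id_comp _))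
    rfl
  · intro X Y
    have := NatTrans.IsMonoidal.tensor (τ := α) ⟨X.carrier, fun _ => ()⟩ ⟨Y.carrier, fun _ => ()⟩
    exact (Iso.inv_comp_eq _).2 this.symm
  · have := NatTrans.IsMonoidal.unit (τ := α)
    exact (Category.id_comp _).symm.trans (this.trans (comp_of_eq_id (D.map_id _)))

/-- The three values are those of a monoidal transformation on the free generators of the groupoid
of triangles; the third is the one required by the right unit law. -/
theorem exists_compositionData (D : IsoArrow FI.{w} ⥤ E) [D.Braided]
    (m : D.obj ⟨𝟙 pt⟩ ⊗ D.obj ⟨𝟙 pt⟩ ⟶ D.obj ⟨𝟙 pt⟩)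
    (s : D.obj ⟨𝟙 pt⟩ ⊗ D.obj ⟨fromEmpty⟩ ⟶ D.obj ⟨fromEmpty⟩) :
    ∃ C : CompositionData D, C.comp (𝟙 pt) (𝟙 pt) (𝟙 pt) (Category.comp_id _) = m ∧
      C.comp fromEmpty (𝟙 pt) fromEmpty (Category.comp_id _) = s ∧
      C.comp (𝟙 (𝟙_ FI)) fromEmpty fromEmpty (Category.id_comp _) =
        D.obj ⟨fromEmpty⟩ ◁ η D ≫ (ρ_ _).hom := by
  obtain ⟨α, hα, h⟩ := Triangle.freelyGenerates_generator.exists_natTrans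
    (tensorFunctor (Triangle.sndFunctor FI ⋙ D) (Triangle.fstFunctor FI ⋙ D))
    (Triangle.compFunctor FI ⋙ D) (fun
      | 0 => m
      | 1 => s
      | 2 => D.obj ⟨fromEmpty⟩ ◁ η D ≫ (ρ_ _).hom)
  exact ⟨.ofNatTrans D α, h 0, h 1, h 2⟩

end FI

/-- An isomorphism of pairs from isomorphisms of the monoids and of the modules. -/
def MonoidModulePair.isoMk {P Q : MonoidModulePair E} (eA : P.A ≅ Q.A) (eM : P.M ≅ Q.M)
    [IsMonHom eA.hom] (h : ModObj.smul (M := P.A) (X := P.M) ≫ eM.hom =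
      (eA.hom ⊗ₘ eM.hom) ≫ ModObj.smul (M := Q.A) (X := Q.M)) : P ≅ Q where
  hom := { homA := eA.hom, homM := eM.hom, smul_hom := h }
  inv :=
    { homA := eA.inv
      homM := eM.inv
      smul_hom := by
        have h' {A M A' M' : E} {a : A ≅ A'} {m : M ≅ M'} {s : A ⊗ M ⟶ M} {s' : A' ⊗ M' ⟶ M'}
            (h : s ≫ m.hom = (a.hom ⊗ₘ m.hom) ≫ s') : s' ≫ m.inv = (a.inv ⊗ₘ m.inv) ≫ s := by
          rw [Iso.comp_inv_eq, Category.assoc, h, tensorHom_comp_tensorHom_assoc]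
          simp
        exact h' h }
  hom_inv_id := MonoidModulePair.hom_ext eA.hom_inv_id eM.hom_inv_id
  inv_hom_id := MonoidModulePair.hom_ext eA.inv_hom_id eM.inv_hom_id

namespace WeakEnrichmentFunctor

/-- The structure of `Q` is transported along `eA` and `eM` and extended from generators to unit and
composition data; the remaining axioms are checked on chains in the point. -/
theorem exists_toPair_iso (Q : MonoidModulePair E) (D : IsoArrow FI.{w} ⥤ E) [D.Braided]
    (eA : Q.A ≅ D.obj ⟨𝟙 FI.pt⟩) (eM : Q.M ≅ D.obj ⟨FI.fromEmpty⟩) :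
    ∃ P : WeakEnrichmentFunctor FI.{w} E, Nonempty ((toPair E).obj P ≅ Q) := by
  let := MonObj.ofIso eA
  let := ModObj.ofIso eA eM
  obtain ⟨U, hU⟩ := FI.exists_unitData D (MonObj.one (X := D.obj ⟨𝟙 FI.pt⟩))
  obtain ⟨C, hm, hs, he⟩ := FI.exists_compositionData D (MonObj.mul (X := D.obj ⟨𝟙 FI.pt⟩))
    (ModObj.smul (M := D.obj ⟨𝟙 FI.pt⟩) (X := D.obj ⟨FI.fromEmpty⟩))
  have hl {X Y : FI.{w}} (f : X ⟶ Y) :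
      U.unit Y ▷ D.obj ⟨f⟩ ≫ C.comp f (𝟙 Y) f (Category.comp_id f) = (λ_ _).hom := by
    refine FI.arrow_induction (P := fun {_ Y} f =>
      U.unit Y ▷ D.obj ⟨f⟩ ≫ C.comp f (𝟙 Y) f (Category.comp_id f) = (λ_ _).hom)
      U.leftUnit_of_iso U.leftUnit_tensor (UnitData.leftUnit_tensorUnit C U) ?_ ?_ f
    · rw [hU, hm]
      exact MonObj.one_mul _
    · rw [hU, hs]
      exact ModObj.one_smul_self _ _
  have hr {X Y : FI.{w}} (f : X ⟶ Y) :
      D.obj ⟨f⟩ ◁ U.unit X ≫ C.comp (𝟙 X) f f (Category.id_comp f) = (ρ_ _).hom := by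
    refine FI.arrow_induction (P := fun {X _} f =>
      D.obj ⟨f⟩ ◁ U.unit X ≫ C.comp (𝟙 X) f f (Category.id_comp f) = (ρ_ _).hom)
      U.rightUnit_of_iso U.rightUnit_tensor (UnitData.rightUnit_tensorUnit C U) ?_ ?_ f
    · rw [hU, hm]
      exact MonObj.mul_one _
    -- This case explains the value on the third generator: `ε` and `η` cancel and leave the right
    -- unitor.
    · rw [U.tensorUnit, he, ← Category.assoc, ← MonoidalCategory.whiskerLeft_comp, ε_η,
        MonoidalCategory.whiskerLeft_id, Category.id_comp]
  have hC {X : FI.{w}} (f : 𝟙_ FI ⟶ X) : C.comp (𝟙 (𝟙_ FI)) f f (Category.id_comp _) =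
      D.obj ⟨f⟩ ◁ η D ≫ (ρ_ _).hom := by
    have aux {A I C : E} {e : I ⟶ I} (he : e = 𝟙 I) (c : A ⊗ I ⟶ C) : c = A ◁ e ≫ c := by
      rw [he, MonoidalCategory.whiskerLeft_id, Category.id_comp]
    rw [← hr f, U.tensorUnit, ← Category.assoc, ← MonoidalCategory.whiskerLeft_comp]
    exact aux (η_ε D) _
  have ha {W X Y Z : FI.{w}} (f : W ⟶ X) (g : X ⟶ Y) (h : Y ⟶ Z) : C.IsAssoc f g h := by
    -- This settles three of the five basic chains; the other two are associativity of the monoid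
    -- and of the action.
    have h₁ {X Y : FI.{w}} (g : 𝟙_ FI ⟶ X) (h : X ⟶ Y) : C.IsAssoc (𝟙 (𝟙_ FI)) g h :=
      .of_comp_id_tensorUnit hC g h
    refine FI.chain_induction (P := fun f g h => C.IsAssoc f g h)
      CompositionData.IsAssoc.of_iso CompositionData.IsAssoc.tensor (h₁ _ _) ?_ ?_ (h₁ _ _)
      (h₁ _ _) f g h
    · rintro fg gh fgh rfl rfl rfl t
      exact (congrArg₂ (fun r r' => r ▷ _ ≫ r') hm hm).trans ((MonObj.mul_assoc _).trans
        (congrArg₂ (fun r r' => (α_ _ _ _).hom ≫ _ ◁ r ≫ r') hm hm).symm)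
    · rintro fg gh fgh rfl rfl rfl t
      exact (congrArg₂ (fun r r' => r ▷ _ ≫ r') hm hs).trans ((ModObj.mul_smul_self _ _).trans
        (congrArg₂ (fun r r' => (α_ _ _ _).hom ≫ _ ◁ r ≫ r') hs hs).symm)
  let P : WeakEnrichmentFunctor FI.{w} E :=
    { D := D
      comp := C.comp
      unit := U.unit
      comp_naturality := C.naturality
      unit_naturality := U.naturality
      comp_assoc := fun t₁ t₂ t₃ t₄ => ha _ _ _ t₁ t₂ t₃ t₄
      unit_comp := hl
      comp_unit := hr
      comp_tensor := C.tensor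
      unit_tensor := U.tensor
      unit_tensorUnit := U.tensorUnit }
  let e : ((toPair E).obj P).A ≅ Q.A := eA.symm
  have : IsMonHom e.hom :=
    { one_hom := by
        have : U.unit FI.pt ≫ eA.inv = MonObj.one := by
          rw [hU]
          exact (Category.assoc _ _ _).trans (comp_of_eq_id eA.hom_inv_id)
        exact this
      mul_hom := by
        have : C.comp (𝟙 FI.pt) (𝟙 FI.pt) (𝟙 FI.pt) (Category.comp_id _) ≫ eA.inv =
            (eA.inv ⊗ₘ eA.inv) ≫ MonObj.mul := by
          rw [hm, MonObj.ofIso_mul, Category.assoc, Category.assoc, Iso.hom_inv_id,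
            Category.comp_id]
        exact this }
  refine ⟨P, ⟨MonoidModulePair.isoMk (P := (toPair E).obj P) e eM.symm ?_⟩⟩
  have : C.comp FI.fromEmpty (𝟙 FI.pt) FI.fromEmpty (Category.comp_id _) ≫ eM.inv =
      (eA.inv ⊗ₘ eM.inv) ≫ ModObj.smul (M := Q.A) (X := Q.M) := by
    rw [hs]
    refine (Category.assoc _ _ _).trans (congrArg (_ ≫ ·) ?_)
    exact (Category.assoc _ _ _).trans (comp_of_eq_id eM.hom_inv_id)
  exact this

instance : (toPair.{w} E).EssSurj where
  mem_essImage Q :=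
    let V : Bool → E := fun b => match b with
      | true => Q.A
      | false => Q.M
    exists_toPair_iso Q (IsoArrow.freelyGenerates_generator.lift V)
      (IsoArrow.freelyGenerates_generator.liftGenerator V true).symm
      (IsoArrow.freelyGenerates_generator.liftGenerator V false).symm

end WeakEnrichmentFunctor

end

theorem mainTheorem9 (E : Type u) [Category.{v} E] [MonoidalCategory E] [SymmetricCategory E] :
    (WeakEnrichmentFunctor.toPair.{w, v, u} E).IsEquivalence := { }
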